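/- Let $0<L_0<L_2$, $H>0$, $\kappa\ge 0$, and let $\Omega\subset\mathbb R^2$ (coordinates $(x,z)$) be a bounded open set with $\Omega\cap\{x<L_2\}=(0,L_2)\times(0,H)$ such that $\Omega_2=\Omega\cap\{x>L_0\}$ is connected with Lipschitz boundary. Up to a set of zero length, $\partial\Omega$ is the disjoint union of $\Gamma_L=\{0\}\times(0,H)$ and of measurable parts $\Gamma_T\supset(0,L_2)\times\{H\}$, $\Gamma_B\supset(0,L_2)\times\{0\}$ and $\Gamma_R$. Put $\Omega_1=(0,L_0)$, $\Gamma=\{L_0\}\times(0,H)$, and write $\bar f(x)=\frac1H\int_0^H f(x,z)\,dz$. Let $F\in L^2(\Omega)$, let $\gamma_1$ be integrable on $\Gamma_L$, and let $\gamma_2$ be the trace on $\Gamma_R$ of a function of $H^1(\Omega_2)$; $n$ denotes the outward unit normal of $\Omega_2$, so $\partial_n=-\partial_x$ on $\Gamma$. For $\lambda>0$ the Schwarz iteration is the following. Given $u_2^0\in H^1(\Omega_2)$ possessing a normal derivative in $L^2(\Gamma)$ (in the sense of Green's formula, with $\Delta u_2^0\in L^2(\Omega_2)$), for $k\ge 0$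 solve $$-(u_1^{k+1})''+\tfrac{\kappa}{H}u_1^{k+1}=\bar F\ \text{ in }(0,L_0),\qquad u_1^{k+1}(0)=\bar\gamma_1,\qquad \Big(\tfrac{\partial}{\partial x}+\lambda\Big)u_1^{k+1}(L_0)=\frac1H\int_0^H\Big(\tfrac{\partial}{\partial x}+\lambda\Big)u_2^{k}(L_0,z)\,dz,$$ and then solve, in the weak sense in $H^1(\Omega_2)$, $$-\Delta u_2^{k+1}=F\ \text{in }\Omega_2,\quad \partial_n u_2^{k+1}=0\ \text{on }\Gamma_T\cap\partial\Omega_2,\quad \partial_n u_2^{k+1}+\kappa u_2^{k+1}=0\ \text{on }\Gamma_B\cap\partial\Omega_2,\quad u_2^{k+1}=\gamma_2\ \text{on }\Gamma_R,$$ $$-\frac{\partial u_2^{k+1}}{\partial x}(L_0,z)+\lambda u_2^{k+1}(L_0,z)=-(u_1^{k+1})'(L_0)+\lambda u_1^{k+1}(L_0)\quad\text{on }\Gamma .$$ Then, for every $\lambda>0$, the iteration can be carried out from every such $u_2^0$, and there is a pair $(u_1^\lambda,u_2^\lambda)\in H^1(\Omega_1)\times H^1(\Omega_2)$, not depending on $u_2^0$,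 such that $(u_1^k,u_2^k)\to(u_1^\lambda,u_2^\lambda)$ in $H^1(\Omega_1)\times H^1(\Omega_2)$ for every such iteration. The limit solves the above equations in $(0,L_0)$ and $\Omega_2$ with the above outer boundary conditions and the above Robin condition on $\Gamma$ (without the indices $k+1$), and it satisfies the physical coupling constraints $$u_1^\lambda(L_0)=\frac1H\int_0^H u_2^\lambda(L_0,z)\,dz,\qquad (u_1^\lambda)'(L_0)=\frac1H\int_0^H\frac{\partial u_2^\lambda}{\partial x}(L_0,z)\,dz .$$ -/

import Mathlib

open MeasureTheory Filter Topology Set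
open scoped ContDiff NNReal ENNReal

noncomputable section

namespace SchwarzCoupling

/-- The Euclidean plane; the coordinates are `x = p 0` and `z = p 1`. -/
abbrev Plane : Type := EuclideanSpace ℝ (Fin 2)

/-- The point `(x, z)`. -/
def pt (x z : ℝ) : Plane := !₂[x, z]

/-- Arc length: one-dimensional Hausdorff measure of the Euclidean plane. -/
def arc : Measure Plane := Measure.hausdorffMeasure 1

/-- `Ω` has a Lipschitz boundary: near each boundary point `p`, in suitable orthonormal coordinates
`(s, t)` centred at `p`, the set `Ω` is the part of a box lying above a Lipschitz graph. -/
def HasLipschitzBoundary (Ω : Set Plane) : Prop :=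
  ∀ p ∈ frontier Ω, ∃ (e : Plane ≃ₗᵢ[ℝ] Plane) (r h : ℝ) (K : ℝ≥0) (ψ : ℝ → ℝ),
    0 < r ∧ 0 < h ∧ LipschitzWith K ψ ∧ (∀ s, |s| < r → |ψ s| < h) ∧
    ∀ s t, |s| < r → |t| < h → (p + e (pt s t) ∈ Ω ↔ ψ s < t)

/-- Elements of the Sobolev space `H¹(Ω)`: a square integrable function together with its square
integrable weak gradient. -/
structure H1 (Ω : Set Plane) where
  /-- the function -/
  val : Plane → ℝ
  /-- its weak gradient -/
  grad : Plane → Plane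
  memLp_val : MemLp val 2 (volume.restrict Ω)
  memLp_grad : MemLp grad 2 (volume.restrict Ω)
  weak : ∀ φ : Plane → ℝ, ContDiff ℝ ∞ φ → HasCompactSupport φ → tsupport φ ⊆ Ω →
    ∫ p in Ω, val p • gradient φ p = - ∫ p in Ω, φ p • grad p

/-- `w ∈ L²(∂Ω)` is the boundary trace of `u ∈ H¹(Ω)`: it is the `L²(∂Ω)`-limit of the boundary
values of functions smooth up to the boundary that converge to `u` in `H¹(Ω)`. -/
def H1.HasTrace {Ω : Set Plane} (u : H1 Ω) (w : Plane → ℝ) : Prop :=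
  MemLp w 2 (arc.restrict (frontier Ω)) ∧
  ∃ φ : ℕ → Plane → ℝ, (∀ n, ContDiff ℝ ∞ (φ n)) ∧
    Tendsto (fun n => eLpNorm (fun p => φ n p - u.val p) 2 (volume.restrict Ω)) atTop (𝓝 0) ∧
    Tendsto (fun n => eLpNorm (fun p => gradient (φ n) p - u.grad p) 2 (volume.restrict Ω))
      atTop (𝓝 0) ∧
    Tendsto (fun n => eLpNorm (fun p => φ n p - w p) 2 (arc.restrict (frontier Ω))) atTop (𝓝 0)

/-- `q ∈ L²(Γ)` is the outward normal derivative of `u` on the part `Γ` of `∂Ω`: the weak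
Laplacian `ℓ` of `u` is square integrable, and Green's formula
`∫_Ω ∇u·∇v + ∫_Ω (Δu) v = ∫_Γ q v` holds for all `v ∈ H¹(Ω)` that vanish on `∂Ω \ Γ`. -/
def H1.HasNormalDeriv {Ω : Set Plane} (u : H1 Ω) (Γ : Set Plane) (q : Plane → ℝ) : Prop :=
  MemLp q 2 (arc.restrict Γ) ∧
  ∃ l : Plane → ℝ, MemLp l 2 (volume.restrict Ω) ∧
    ∀ (v : H1 Ω) (w : Plane → ℝ), v.HasTrace w →
      (∀ᵐ p ∂(arc.restrict (frontier Ω \ Γ)), w p = 0) →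
      (∫ p in Ω, inner ℝ (u.grad p) (v.grad p)) + ∫ p in Ω, l p * v.val p
        = ∫ p in Γ, q p * w p ∂arc

/-- The computational domain. For `x < L₂` it is the thin rectangle `(0, L₂) × (0, H)`, and the
interface abscissa `L₀` is taken in `(0, L₂)`. The boundary consists of the left side, the top
part `ΓT`, the bottom part `ΓB` and the right part `ΓR`. -/
structure Geometry where
  L₀ : ℝ
  L₂ : ℝ
  H : ℝ
  L₀_pos : 0 < L₀
  L₀_lt : L₀ < L₂
  H_pos : 0 < H
  Ω : Set Plane
  ΓT : Set Plane
  ΓB : Set Plane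
  ΓR : Set Plane
  isOpen : IsOpen Ω
  bounded : Bornology.IsBounded Ω
  thin : ∀ p : Plane, p 0 < L₂ → (p ∈ Ω ↔ 0 < p 0 ∧ 0 < p 1 ∧ p 1 < H)
  connected : IsConnected (Ω ∩ {p | L₀ < p 0})
  lipschitz : HasLipschitzBoundary (Ω ∩ {p | L₀ < p 0})
  measurable_ΓT : MeasurableSet ΓT
  measurable_ΓB : MeasurableSet ΓB
  measurable_ΓR : MeasurableSet ΓR
  ΓT_subset : ΓT ⊆ frontier Ω
  ΓB_subset : ΓB ⊆ frontier Ω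
  ΓR_subset : ΓR ⊆ frontier Ω
  disjoint_TB : Disjoint ΓT ΓB
  disjoint_TR : Disjoint ΓT ΓR
  disjoint_BR : Disjoint ΓB ΓR
  top_thin : ∀ x, 0 < x → x < L₂ → pt x H ∈ ΓT
  bottom_thin : ∀ x, 0 < x → x < L₂ → pt x 0 ∈ ΓB
  cover : arc (frontier Ω \ (ΓT ∪ ΓB ∪ ΓR ∪ {p | p 0 = 0 ∧ 0 < p 1 ∧ p 1 < H})) = 0

namespace Geometry

variable (G : Geometry)

/-- The subdomain `Ω₂ = Ω ∩ {x > L₀}` in which the 2-D model is kept. -/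
def Ω₂ : Set Plane := G.Ω ∩ {p | G.L₀ < p 0}

/-- The interface `Γ = {L₀} × (0, H)`. -/
def Γ : Set Plane := {p | p 0 = G.L₀ ∧ 0 < p 1 ∧ p 1 < G.H}

/-- The average over `0 < z < H` of `f (x, z)`. -/
def avg (f : Plane → ℝ) (x : ℝ) : ℝ := (1 / G.H) * ∫ z in (0 : ℝ)..G.H, f (pt x z)

end Geometry

/-- `γ` is the trace on `ΓR` of some element of `H¹(Ω₂)`, i.e. it lies in `H^{1/2}(ΓR)`. -/
def IsDirichletDatum (G : Geometry) (γ : Plane → ℝ) : Prop :=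
  ∃ (u : H1 G.Ω₂) (w : Plane → ℝ), u.HasTrace w ∧
    ∀ᵐ p ∂(arc.restrict (G.ΓR ∩ frontier G.Ω₂)), w p = γ p

/-- `u`, with derivative `du`, is the (`H²`) solution of the 1-D model
`-u'' + (κ/H) u = F₁` a.e. in `(0, L₀)`, `u(0) = γ̄₁`, where `F₁` and `γ̄₁` are the vertical
averages of `F` and `γ₁`. -/
structure IsSolution1D (G : Geometry) (κ : ℝ) (F γ₁ : Plane → ℝ) (u du : ℝ → ℝ) : Prop where
  hasDeriv : ∀ x ∈ Icc 0 G.L₀, HasDerivWithinAt u (du x) (Icc 0 G.L₀) x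
  absCont : AbsolutelyContinuousOnInterval du 0 G.L₀
  eqn : ∀ᵐ x, x ∈ Ioo 0 G.L₀ → -deriv du x + κ / G.H * u x = G.avg F x
  left : u 0 = G.avg γ₁ 0

/-- `u` is the weak solution of `-Δu = F` in `Ω₂`, `∂ₙu = 0` on `ΓT`, `∂ₙu + κ u = 0` on `ΓB`,
`u = γ₂` on `ΓR`, and `∂ₙu + lam u = c` on the interface `Γ`. -/
def IsSolution2D (G : Geometry) (κ lam : ℝ) (F γ₂ : Plane → ℝ) (c : ℝ) (u : H1 G.Ω₂) : Prop :=
  ∃ w : Plane → ℝ, u.HasTrace w ∧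
    (∀ᵐ p ∂(arc.restrict (G.ΓR ∩ frontier G.Ω₂)), w p = γ₂ p) ∧
    ∀ (v : H1 G.Ω₂) (y : Plane → ℝ), v.HasTrace y →
      (∀ᵐ p ∂(arc.restrict (G.ΓR ∩ frontier G.Ω₂)), y p = 0) →
      (∫ p in G.Ω₂, inner ℝ (u.grad p) (v.grad p))
          + κ * (∫ p in G.ΓB ∩ frontier G.Ω₂, w p * y p ∂arc)
          + lam * (∫ p in G.Γ, w p * y p ∂arc)
        = (∫ p in G.Ω₂, F p * v.val p) + ∫ p in G.Γ, c * y p ∂arc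

/-- The number `m` is the average over `Γ` of the trace of `u`, and `d` is the average over `Γ` of
`∂u/∂x`. Since the outward normal of `Ω₂` on `Γ` is `-e_x`, one has `∂u/∂x = -∂ₙu` there. -/
def HasInterfaceAverages (G : Geometry) (u : H1 G.Ω₂) (m d : ℝ) : Prop :=
  ∃ w q : Plane → ℝ, u.HasTrace w ∧ u.HasNormalDeriv G.Γ q ∧
    m = G.avg w G.L₀ ∧ d = G.avg (fun p => -q p) G.L₀

/-- The Robin condition `B₁ u₁ = B₁ ū₂` at `x = L₀`, where `B₁ = ∂/∂x + lam`. -/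
def Robin1D (G : Geometry) (lam : ℝ) (u₁ du₁ : ℝ → ℝ) (u₂ : H1 G.Ω₂) : Prop :=
  ∃ m d : ℝ, HasInterfaceAverages G u₂ m d ∧ du₁ G.L₀ + lam * u₁ G.L₀ = d + lam * m

/-- The constant value on `Γ` of `B₂ u₁`, where `B₂ = ∂/∂n₂ + lam = -∂/∂x + lam` and `u₁` is
extended constantly in `z`. -/
def robinDatum2D (G : Geometry) (lam : ℝ) (u₁ du₁ : ℝ → ℝ) : ℝ :=
  -du₁ G.L₀ + lam * u₁ G.L₀

/-- The Schwarz iteration started from `u₂ 0`. The entries `u₁ 0`, `du₁ 0` play no role. -/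
def IsSchwarzIteration (G : Geometry) (κ lam : ℝ) (F γ₁ γ₂ : Plane → ℝ)
    (u₁ du₁ : ℕ → ℝ → ℝ) (u₂ : ℕ → H1 G.Ω₂) : Prop :=
  ∀ k : ℕ,
    IsSolution1D G κ F γ₁ (u₁ (k + 1)) (du₁ (k + 1)) ∧
    Robin1D G lam (u₁ (k + 1)) (du₁ (k + 1)) (u₂ k) ∧
    IsSolution2D G κ lam F γ₂ (robinDatum2D G lam (u₁ (k + 1)) (du₁ (k + 1))) (u₂ (k + 1))

/-- Convergence in `H¹(0, L₀)`. -/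
def ConvergesH1Interval (L₀ : ℝ) (u du : ℕ → ℝ → ℝ) (v dv : ℝ → ℝ) : Prop :=
  Tendsto (fun k => eLpNorm (fun x => u k x - v x) 2 (volume.restrict (Ioo 0 L₀))) atTop (𝓝 0) ∧
  Tendsto (fun k => eLpNorm (fun x => du k x - dv x) 2 (volume.restrict (Ioo 0 L₀))) atTop (𝓝 0)

/-- Convergence in `H¹(Ω)`. -/
def ConvergesH1 {Ω : Set Plane} (u : ℕ → H1 Ω) (v : H1 Ω) : Prop :=
  Tendsto (fun k => eLpNorm (fun p => (u k).val p - v.val p) 2 (volume.restrict Ω))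
    atTop (𝓝 0) ∧
  Tendsto (fun k => eLpNorm (fun p => (u k).grad p - v.grad p) 2 (volume.restrict Ω))
    atTop (𝓝 0)

end SchwarzCoupling

end

/-! The two subdomains exchange a single number per step, so the iteration is a scalar affine
recursion. With `k = κ/H`, the solutions in `(0, L₀)` with the prescribed left value are `p + a S`,
where `p` is one of them and `S'' = k S`, `S(0) = 0`, `S' = C`. The Robin datum on `Γ` is a constant
`c`, and the solution in `Ω₂` is `x₀ + c x₁`, where `x₁` is the response to the datum `1` with all
other data zero.

Let `M` be the mean of `x₁` over `Γ`. Since `∂u₂/∂x = lam u₂ - c` on `Γ`, the coefficients satisfy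
`a (k+1) = A + B a k` with `B = (2 lam M - 1)(lam S - C)/(C + lam S)` at `L₀`. Testing the equation
of `x₁` with `x₁` and applying Cauchy–Schwarz gives `0 ≤ lam M ≤ 1`, so the first factor is at most
one in absolute value; positivity of `S` and `C` makes the remaining quotient strictly smaller than
one. Hence `|B| < 1`, and `a k` converges to the fixed point. At the fixed point both Robin
conditions hold with the same data; their sum gives equality of the means, and then either one gives
equality of the fluxes.

The analytic work justifies this reduction. `exists_trace_bound` makes traces unique,
`Geometry.controlled_Ω₂` makes the Robin form coercive (Lax–Milgram then yields
`Geometry.exists_affine_solution2D`), and `Geometry.normalDeriv_ae_eq` makes the flux unique, so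
that `Geometry.hasInterfaceAverages_iff` computes the transmitted number. Both inequalities are
proved by integrating along segments, without compactness of embeddings, and extended to `H¹` by
density: a trace is by definition a limit of smooth boundary values. -/

noncomputable section

namespace SchwarzCoupling

/-! ### The equation `-u'' + k u = f` on an interval. -/

/-- `C` and `S` are the solutions of `y'' = k y` with `(y, y')(0) = (1, 0)` and `(0, 1)`. -/
structure IsFundamentalPair (k : ℝ) (C S : ℝ → ℝ) : Prop where
  deriv_C : ∀ x, HasDerivAt C (k * S x) x
  deriv_S : ∀ x, HasDerivAt S (C x) x
  C_zero : C 0 = 1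
  S_zero : S 0 = 0
  C_pos : ∀ x, 0 < C x
  S_pos : ∀ x, 0 < x → 0 < S x

lemma exists_isFundamentalPair {k : ℝ} (hk : 0 ≤ k) : ∃ C S, IsFundamentalPair k C S := by
  rcases hk.eq_or_lt with rfl | hk
  · exact ⟨fun _ => 1, fun x => x, fun x => by simpa using hasDerivAt_const x (1 : ℝ),
      fun x => hasDerivAt_id x, rfl, rfl, fun _ => one_pos, fun _ h => h⟩
  · have hs : 0 < √k := Real.sqrt_pos.2 hk
    refine ⟨fun x => Real.cosh (√k * x), fun x => Real.sinh (√k * x) / √k, fun x => ?_, fun x => ?_,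
      by simp, by simp, fun x => Real.cosh_pos _, fun x hx => ?_⟩
    · have h := ((hasDerivAt_id x).const_mul (√k)).cosh
      refine h.congr_deriv ?_
      have := Real.mul_self_sqrt hk.le
      simp only [id, mul_one]
      field_simp
      linear_combination (Real.sinh (√k * x)) * this
    · have h := (((hasDerivAt_id x).const_mul (√k)).sinh).div_const (√k)
      refine h.congr_deriv ?_
      simp only [id, mul_one]
      field_simp
    · exact div_pos (Real.sinh_pos_iff.2 (mul_pos hs hx)) hs

namespace IsFundamentalPair

variable {k : ℝ} {C S : ℝ → ℝ}

lemma continuous_C (h : IsFundamentalPair k C S) : Continuous C :=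
  continuous_iff_continuousAt.2 fun x => (h.deriv_C x).continuousAt

lemma continuous_S (h : IsFundamentalPair k C S) : Continuous S :=
  continuous_iff_continuousAt.2 fun x => (h.deriv_S x).continuousAt

lemma wronskian (h : IsFundamentalPair k C S) (x : ℝ) : C x ^ 2 - k * S x ^ 2 = 1 := by
  have hd : ∀ y, HasDerivAt (fun y => C y ^ 2 - k * S y ^ 2) 0 y := fun y =>
    (((h.deriv_C y).pow 2).sub (((h.deriv_S y).pow 2).const_mul k)).congr_deriv (by simp; ring)
  have := is_const_of_deriv_eq_zero (fun y => (hd y).differentiableAt) (fun y => (hd y).deriv) x 0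
  simpa [h.C_zero, h.S_zero] using this

end IsFundamentalPair

lemma absolutelyContinuousOnInterval_of_hasDerivAt {f f' : ℝ → ℝ} {a b : ℝ} (hab : a ≤ b)
    (hf : ∀ x ∈ Icc a b, HasDerivWithinAt f (f' x) (Icc a b) x) (hc : ContinuousOn f' (Icc a b)) :
    AbsolutelyContinuousOnInterval f a b := by
  obtain ⟨K, hK⟩ := isCompact_Icc.exists_bound_of_continuousOn hc
  have hL : LipschitzOnWith K.toNNReal f (Icc a b) :=
    (convex_Icc a b).lipschitzOnWith_of_nnnorm_hasDerivWithin_le hf fun x hx => by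
      rw [← NNReal.coe_le_coe, coe_nnnorm]
      exact (hK x hx).trans (Real.le_coe_toNNReal K)
  rw [← uIcc_of_le hab] at hL
  exact hL.absolutelyContinuousOnInterval

/-- Variation of constants for `-u'' + k u = f`. -/
lemma exists_solution_secondOrder {k : ℝ} (hk : 0 ≤ k) {f : ℝ → ℝ} (hf : Integrable f) (c L : ℝ)
    (hL : 0 ≤ L) :
    ∃ u du : ℝ → ℝ, (∀ x, HasDerivAt u (du x) x) ∧ AbsolutelyContinuousOnInterval du 0 L ∧
      (∀ᵐ x, -deriv du x + k * u x = f x) ∧ u 0 = c := by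
  obtain ⟨C, S, h⟩ := exists_isFundamentalPair hk
  have hint : ∀ {g : ℝ → ℝ}, Continuous g →
      ∀ x, HasDerivAt (fun x => ∫ t in (0 : ℝ)..x, g t) (g x) x :=
    fun hg x => intervalIntegral.integral_hasDerivAt_right (hg.intervalIntegrable _ _)
      (hg.stronglyMeasurableAtFilter _ _) hg.continuousAt
  -- As `f` is only integrable, its second primitive `Q` is split off: `u = v - Q` with `v'' = k (v
  -- - Q)`, an equation with continuous source to which variation of constants applies classically.
  set P : ℝ → ℝ := fun x => ∫ t in (0 : ℝ)..x, f t with hP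
  have hPc : Continuous P :=
    intervalIntegral.continuous_primitive (fun _ _ => hf.intervalIntegrable) 0
  set Q : ℝ → ℝ := fun x => ∫ t in (0 : ℝ)..x, P t with hQ
  have hQd : ∀ x, HasDerivAt Q (P x) x := hint hPc
  have hQc : Continuous Q := continuous_iff_continuousAt.2 fun x => (hQd x).continuousAt
  set I : ℝ → ℝ := fun x => ∫ t in (0 : ℝ)..x, C t * Q t with hI
  set J : ℝ → ℝ := fun x => ∫ t in (0 : ℝ)..x, S t * Q t with hJ
  have hId : ∀ x, HasDerivAt I (C x * Q x) x := hint (h.continuous_C.mul hQc)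
  have hJd : ∀ x, HasDerivAt J (S x * Q x) x := hint (h.continuous_S.mul hQc)
  set v : ℝ → ℝ := fun x => c * C x - k * (S x * I x - C x * J x) with hv
  set w : ℝ → ℝ := fun x => k * (c * S x - (C x * I x - k * (S x * J x))) with hw
  have hvd : ∀ x, HasDerivAt v (w x) x := fun x =>
    (((h.deriv_C x).const_mul c).sub ((((h.deriv_S x).mul (hId x)).sub
      ((h.deriv_C x).mul (hJd x))).const_mul k)).congr_deriv (by simp only [hw]; ring)
  have hwd : ∀ x, HasDerivAt w (k * (v x - Q x)) x := fun x =>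
    ((((h.deriv_S x).const_mul c).sub (((h.deriv_C x).mul (hId x)).sub
      (((h.deriv_S x).mul (hJd x)).const_mul k))).const_mul k).congr_deriv (by
        simp only [hv]; linear_combination (-k * Q x) * h.wronskian x)
  have hvc : Continuous v := continuous_iff_continuousAt.2 fun x => (hvd x).continuousAt
  refine ⟨fun x => v x - Q x, fun x => w x - P x, fun x => (hvd x).sub (hQd x), ?_, ?_, ?_⟩
  · refine AbsolutelyContinuousOnInterval.sub ?_ ?_
    · exact absolutelyContinuousOnInterval_of_hasDerivAt hL (fun x _ => (hwd x).hasDerivWithinAt)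
        (by fun_prop)
    · exact hf.intervalIntegrable.absolutelyContinuousOnInterval_intervalIntegral (by simp)
  · filter_upwards [LocallyIntegrable.ae_hasDerivAt_integral hf.locallyIntegrable] with x hx
    have := ((hwd x).sub (hx 0)).deriv
    have e : deriv (fun x => w x - P x) x = k * (v x - Q x) - f x := this
    rw [e]; ring
  · simp [hv, hQ, hI, hJ, h.C_zero, h.S_zero]

/-- A solution of `v'' = k v` with `v 0 = 0` is a multiple of `S`. -/
lemma eq_mul_of_secondOrder_homogeneous {k L : ℝ} {C S v dv : ℝ → ℝ} (h : IsFundamentalPair k C S)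
    (hL : 0 ≤ L) (hd : ∀ x ∈ Icc 0 L, HasDerivWithinAt v (dv x) (Icc 0 L) x)
    (hac : AbsolutelyContinuousOnInterval dv 0 L)
    (heq : ∀ᵐ x, x ∈ Ioo 0 L → deriv dv x = k * v x) (h0 : v 0 = 0) :
    ∃ a : ℝ, ∀ x ∈ Icc 0 L, v x = a * S x ∧ dv x = a * C x := by
  have hdc : ContinuousOn dv (Icc 0 L) := by simpa [uIcc_of_le hL] using hac.continuousOn
  have hvac := absolutelyContinuousOnInterval_of_hasDerivAt hL hd hdc
  have hCac : AbsolutelyContinuousOnInterval C 0 L :=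
    absolutelyContinuousOnInterval_of_hasDerivAt hL
    (fun x _ => (h.deriv_C x).hasDerivWithinAt) (h.continuous_S.const_smul k).continuousOn
  have hSac : AbsolutelyContinuousOnInterval S 0 L :=
    absolutelyContinuousOnInterval_of_hasDerivAt hL
    (fun x _ => (h.deriv_S x).hasDerivWithinAt) h.continuous_C.continuousOn
  have key : ∀ᵐ x, x ∈ uIcc 0 L → HasDerivAt v (dv x) x ∧ HasDerivAt dv (k * v x) x := by
    have h₁ : ∀ᵐ x : ℝ, x ≠ 0 := by simp [ae_iff, measure_singleton]
    have h₂ : ∀ᵐ x : ℝ, x ≠ L := by simp [ae_iff, measure_singleton]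
    filter_upwards [heq, hac.ae_differentiableAt, h₁, h₂] with x e hdiff n0 nL hx
    have hx' := hx
    rw [uIcc_of_le hL] at hx'
    have hx'' : x ∈ Ioo 0 L := ⟨lt_of_le_of_ne hx'.1 n0.symm, lt_of_le_of_ne hx'.2 nL⟩
    exact ⟨(hd x hx').hasDerivAt (Icc_mem_nhds hx''.1 hx''.2), e hx'' ▸ (hdiff hx).hasDerivAt⟩
  -- The first integrals `v C - v' S` and `v' C - k v S` have derivative zero only almost
  -- everywhere; absolute continuity makes them constant. The first vanishes at `0`, and the
  -- identity `C² - k S² = 1` recovers `v` and `v'` from them.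
  obtain ⟨p, hp⟩ := ((hvac.mul hCac).sub (hac.mul hSac)).const_of_ae_hasDerivAt_zero (by
    filter_upwards [key] with x hx hxm
    exact (((hx hxm).1.mul (h.deriv_C x)).sub ((hx hxm).2.mul (h.deriv_S x))).congr_deriv (by ring))
  obtain ⟨q, hq⟩ :=
    ((hac.mul hCac).sub ((hvac.mul hSac).const_mul k)).const_of_ae_hasDerivAt_zero (by
    filter_upwards [key] with x hx hxm
    exact (((hx hxm).2.mul (h.deriv_C x)).sub
      (((hx hxm).1.mul (h.deriv_S x)).const_mul k)).congr_deriv (by ring))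
  rw [uIcc_of_le hL] at hp hq
  simp only [Pi.sub_apply, Pi.mul_apply] at hp hq
  have hp0 : p = 0 := by rw [← hp 0 ⟨le_rfl, hL⟩, h0, h.S_zero]; ring
  refine ⟨q, fun x hx => ?_⟩
  have e₁ := hp x hx
  have e₂ := hq x hx
  have e₃ := h.wronskian x
  constructor
  · linear_combination C x * e₁ + S x * e₂ - v x * e₃ + C x * hp0
  · linear_combination k * S x * e₁ + C x * e₂ - dv x * e₃ + k * S x * hp0

/-! ### Coordinates, arc length on the interface, vertical averages. -/

@[simp] lemma pt_zero (x z : ℝ) : pt x z 0 = x := by simp [pt]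

@[simp] lemma pt_one (x z : ℝ) : pt x z 1 = z := by simp [pt]

lemma pt_eta (p : Plane) : pt (p 0) (p 1) = p := by
  ext i; fin_cases i <;> simp

lemma pt_add (x z x' z' : ℝ) : pt x z + pt x' z' = pt (x + x') (z + z') := by
  ext i; fin_cases i <;> simp

lemma smul_pt (c x z : ℝ) : c • pt x z = pt (c * x) (c * z) := by
  ext i; fin_cases i <;> simp

lemma norm_pt_sq (x z : ℝ) : ‖pt x z‖ ^ 2 = x ^ 2 + z ^ 2 := by
  simp [EuclideanSpace.norm_sq_eq, Fin.sum_univ_two]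

/-- Cartesian coordinates as a measurable equivalence. -/
def ptEquiv : (ℝ × ℝ) ≃ᵐ Plane :=
  MeasurableEquiv.finTwoArrow.symm.trans (MeasurableEquiv.toLp 2 (Fin 2 → ℝ))

lemma ptEquiv_apply (q : ℝ × ℝ) : ptEquiv q = pt q.1 q.2 := by
  ext i; fin_cases i <;> rfl

lemma measurePreserving_ptEquiv : MeasurePreserving ptEquiv volume volume :=
  (PiLp.volume_preserving_toLp (Fin 2)).comp (volume_preserving_finTwoArrow ℝ).symm

lemma continuous_pt : Continuous fun q : ℝ × ℝ => pt q.1 q.2 := by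
  unfold pt
  fun_prop

lemma lintegral_plane {f : Plane → ℝ≥0∞} (hf : Measurable f) :
    ∫⁻ p, f p = ∫⁻ x, ∫⁻ z, f (pt x z) := by
  rw [← measurePreserving_ptEquiv.lintegral_comp hf, Measure.volume_eq_prod, lintegral_prod]
  · simp only [ptEquiv_apply]
  · exact (hf.comp ptEquiv.measurable).aemeasurable

lemma lintegral_plane_symm {f : Plane → ℝ≥0∞} (hf : Measurable f) :
    ∫⁻ p, f p = ∫⁻ z, ∫⁻ x, f (pt x z) := by
  rw [← measurePreserving_ptEquiv.lintegral_comp hf, Measure.volume_eq_prod, lintegral_prod_symm]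
  · simp only [ptEquiv_apply]
  · exact (hf.comp ptEquiv.measurable).aemeasurable

lemma isometry_pt_right (x : ℝ) : Isometry fun z => pt x z := by
  refine Isometry.of_dist_eq fun z z' => ?_
  rw [EuclideanSpace.dist_eq, Fin.sum_univ_two]
  simp [Real.sqrt_sq_eq_abs, Real.dist_eq]

namespace Geometry

variable (G : Geometry)

lemma measurableSet_Γ : MeasurableSet G.Γ := by
  have h0 : Measurable fun p : Plane => p 0 := by fun_prop
  have h1 : Measurable fun p : Plane => p 1 := by fun_prop
  exact (measurableSet_eq_fun h0 measurable_const).inter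
    ((measurableSet_lt measurable_const h1).inter (measurableSet_lt h1 measurable_const))

lemma preimage_Γ : (fun z => pt G.L₀ z) ⁻¹' G.Γ = Ioo 0 G.H := by
  ext z; simp [Γ]

lemma measurableEmbedding_interface : MeasurableEmbedding fun z => pt G.L₀ z :=
  (isometry_pt_right G.L₀).isClosedEmbedding.measurableEmbedding

/-- Hausdorff measure is carried along by the isometry `z ↦ (L₀, z)`, and on the line it is Lebesgue
measure. -/
lemma arc_restrict_Γ :
    arc.restrict G.Γ = (volume.restrict (Ioo 0 G.H)).map fun z => pt G.L₀ z := by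
  have h := (isometry_pt_right G.L₀).map_hausdorffMeasure (d := 1) (Or.inl zero_le_one)
  rw [hausdorffMeasure_real] at h
  rw [← preimage_Γ, ← G.measurableEmbedding_interface.restrict_map, h,
    Measure.restrict_restrict G.measurableSet_Γ, inter_eq_left.2]
  · rfl
  · rintro p ⟨hp, -⟩
    exact ⟨p 1, by simp only; rw [← hp, pt_eta]⟩

lemma integral_Γ (f : Plane → ℝ) : ∫ p in G.Γ, f p ∂arc = ∫ z in (0 : ℝ)..G.H, f (pt G.L₀ z) := by
  rw [arc_restrict_Γ, G.measurableEmbedding_interface.integral_map,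
    intervalIntegral.integral_of_le G.H_pos.le, integral_Ioc_eq_integral_Ioo]

lemma avg_eq_integral_Γ (f : Plane → ℝ) : G.avg f G.L₀ = 1 / G.H * ∫ p in G.Γ, f p ∂arc := by
  rw [integral_Γ, avg]

lemma arc_Γ : arc G.Γ = ENNReal.ofReal G.H := by
  have h : arc.restrict G.Γ univ = ENNReal.ofReal G.H := by
    rw [arc_restrict_Γ, G.measurableEmbedding_interface.map_apply]
    simp
  simpa using h

/-- Square integrable functions on the bounded set `Ω` are integrable, and Fubini applies on `(0,
L₀) × (0, H)`, which lies in `Ω` because `L₀ < L₂`. -/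
lemma integrableOn_avg {F : Plane → ℝ} (hF : MemLp F 2 (volume.restrict G.Ω)) :
    IntegrableOn (G.avg F) (Ioo 0 G.L₀) := by
  have hfin : IsFiniteMeasure (volume.restrict G.Ω) :=
    ⟨by simpa using G.bounded.measure_lt_top⟩
  have h1 : IntegrableOn F G.Ω := hF.integrable (by norm_num)
  have h2 : IntegrableOn (F ∘ ptEquiv) (ptEquiv ⁻¹' G.Ω) :=
    (measurePreserving_ptEquiv.restrict_preimage_emb ptEquiv.measurableEmbedding
      G.Ω).integrable_comp_emb ptEquiv.measurableEmbedding |>.2 h1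
  have h3 : IntegrableOn (F ∘ ptEquiv) (Ioo 0 G.L₀ ×ˢ Ioo 0 G.H) := by
    refine h2.mono_set ?_
    rintro ⟨x, z⟩ ⟨hx, hz⟩
    rw [mem_preimage, ptEquiv_apply, G.thin _ (by simpa using hx.2.trans G.L₀_lt)]
    exact ⟨by simpa using hx.1, by simpa using hz⟩
  rw [IntegrableOn, Measure.volume_eq_prod, ← Measure.prod_restrict] at h3
  refine (h3.integral_prod_left.const_mul (1 / G.H)).congr (ae_of_all _ fun x => ?_)
  simp only [avg, Function.comp_apply, ptEquiv_apply]
  rw [intervalIntegral.integral_of_le G.H_pos.le, integral_Ioc_eq_integral_Ioo]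

end Geometry

/-! ### The one-dimensional model: its solutions form an affine line. -/

section OneDimensional

variable {G : Geometry} {κ : ℝ} {F γ₁ : Plane → ℝ}

lemma exists_isSolution1D (hκ : 0 ≤ κ) (hF : MemLp F 2 (volume.restrict G.Ω)) :
    ∃ u du, IsSolution1D G κ F γ₁ u du := by
  have hf : Integrable ((Ioo 0 G.L₀).indicator (G.avg F)) :=
    (integrable_indicator_iff measurableSet_Ioo).2 (G.integrableOn_avg hF)
  obtain ⟨u, du, hd, hac, heq, h0⟩ := exists_solution_secondOrder (div_nonneg hκ G.H_pos.le) hf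
    (G.avg γ₁ 0) G.L₀ G.L₀_pos.le
  refine ⟨u, du, fun x _ => (hd x).hasDerivWithinAt, hac, ?_, h0⟩
  filter_upwards [heq] with x hx hm
  rw [hx, indicator_of_mem hm]

lemma IsSolution1D.add_smul {C S u du : ℝ → ℝ} (h : IsFundamentalPair (κ / G.H) C S)
    (hu : IsSolution1D G κ F γ₁ u du) (a : ℝ) :
    IsSolution1D G κ F γ₁ (fun x => u x + a * S x) (fun x => du x + a * C x) where
  hasDeriv x hx := (hu.hasDeriv x hx).add ((h.deriv_S x).const_mul a).hasDerivWithinAt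
  absCont := hu.absCont.add (AbsolutelyContinuousOnInterval.const_mul a
    (absolutelyContinuousOnInterval_of_hasDerivAt G.L₀_pos.le
      (fun x _ => (h.deriv_C x).hasDerivWithinAt)
      (continuous_const.mul h.continuous_S).continuousOn))
  eqn := by
    filter_upwards [hu.eqn, hu.absCont.ae_differentiableAt] with x hx hdiff hm
    have hm' : x ∈ uIcc 0 G.L₀ := by
      rw [uIcc_of_le G.L₀_pos.le]; exact Ioo_subset_Icc_self hm
    have e : deriv (fun x => du x + a * C x) x = deriv du x + a * (κ / G.H * S x) :=
      ((hdiff hm').hasDerivAt.add ((h.deriv_C x).const_mul a)).deriv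
    rw [e, ← hx hm]; ring
  left := by simp [hu.left, h.S_zero]

lemma IsSolution1D.eq_add_smul {C S u du v dv : ℝ → ℝ} (h : IsFundamentalPair (κ / G.H) C S)
    (hu : IsSolution1D G κ F γ₁ u du) (hv : IsSolution1D G κ F γ₁ v dv) :
    ∃ a : ℝ, ∀ x ∈ Icc 0 G.L₀, v x = u x + a * S x ∧ dv x = du x + a * C x := by
  obtain ⟨a, ha⟩ := eq_mul_of_secondOrder_homogeneous (v := fun x => v x - u x)
    (dv := fun x => dv x - du x) h G.L₀_pos.le
    (fun x hx => (hv.hasDeriv x hx).sub (hu.hasDeriv x hx)) (hv.absCont.sub hu.absCont) (by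
      filter_upwards [hu.eqn, hv.eqn, hu.absCont.ae_differentiableAt,
        hv.absCont.ae_differentiableAt] with x eu ev du' dv' hm
      have hm' : x ∈ uIcc 0 G.L₀ := by
        rw [uIcc_of_le G.L₀_pos.le]; exact Ioo_subset_Icc_self hm
      have e : deriv (fun x => dv x - du x) x = deriv dv x - deriv du x :=
        ((dv' hm').hasDerivAt.sub (du' hm').hasDerivAt).deriv
      rw [e]
      linear_combination eu hm - ev hm)
    (by simp [hu.left, hv.left])
  refine ⟨a, fun x hx => ?_⟩
  have := ha x hx
  constructor <;> linarith [this.1, this.2]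

end OneDimensional

/-! ### Estimates along segments and propagation of `L²` control. -/

lemma lintegral_sq_le {α : Type*} [MeasurableSpace α] (μ : Measure α) {f : α → ℝ≥0∞}
    (hf : AEMeasurable f μ) : (∫⁻ x, f x ∂μ) ^ 2 ≤ μ univ * ∫⁻ x, f x ^ 2 ∂μ := by
  have h := ENNReal.lintegral_mul_le_Lp_mul_Lq μ Real.HolderConjugate.two_two
    (f := fun _ => 1) (g := f) aemeasurable_const hf
  simp only [Pi.mul_apply, one_mul, ENNReal.rpow_two, one_pow, lintegral_one] at h
  calc (∫⁻ x, f x ∂μ) ^ 2 ≤ (μ univ ^ (1 / 2 : ℝ) * (∫⁻ x, f x ^ 2 ∂μ) ^ (1 / 2 : ℝ)) ^ 2 := by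
        gcongr
    _ = _ := by
        rw [mul_pow, ← ENNReal.rpow_natCast, ← ENNReal.rpow_natCast, ← ENNReal.rpow_mul,
          ← ENNReal.rpow_mul]
        norm_num

lemma enorm_sq_le_two_mul {a b : ℝ} : ‖a‖ₑ ^ 2 ≤ 2 * ‖b‖ₑ ^ 2 + 2 * ‖a - b‖ₑ ^ 2 := by
  simp only [← ofReal_norm, ← ENNReal.ofReal_pow (norm_nonneg _)]
  rw [show (2 : ℝ≥0∞) = ENNReal.ofReal 2 by simp, ← ENNReal.ofReal_mul (by norm_num),
    ← ENNReal.ofReal_mul (by norm_num), ← ENNReal.ofReal_add (by positivity) (by positivity)]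
  refine ENNReal.ofReal_le_ofReal ?_
  simp only [Real.norm_eq_abs, sq_abs]
  nlinarith [sq_nonneg (a - 2 * b)]

variable {φ : Plane → ℝ}

lemma continuous_gradient (hφ : ContDiff ℝ 1 φ) : Continuous (gradient φ) :=
  (InnerProductSpace.toDual ℝ Plane).symm.continuous.comp (hφ.continuous_fderiv one_ne_zero)

/-- Difference of values along a segment, by the fundamental theorem of calculus. -/
lemma enorm_sub_sq_le (hφ : ContDiff ℝ 1 φ) (x n : Plane) {s τ : ℝ} (hs : s ∈ Icc 0 τ) :
    ‖φ (x + s • n) - φ x‖ₑ ^ 2 ≤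
      ENNReal.ofReal τ * ‖n‖ₑ ^ 2 * ∫⁻ t in Ioc 0 τ, ‖gradient φ (x + t • n)‖ₑ ^ 2 := by
  have hd : ∀ t, HasDerivAt (fun t : ℝ => φ (x + t • n))
      (inner ℝ (gradient φ (x + t • n)) n) t := by
    intro t
    have h1 : HasDerivAt (fun t : ℝ => x + t • n) n t := by
      simpa using ((hasDerivAt_id t).smul_const n).const_add x
    have h2 := ((hφ.differentiable one_ne_zero) (x + t • n)).hasFDerivAt.comp_hasDerivAt t h1
    rwa [← inner_gradient_left] at h2
  have hgc : Continuous fun t : ℝ => gradient φ (x + t • n) :=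
    (continuous_gradient hφ).comp (by fun_prop)
  have hc : Continuous fun t : ℝ => inner ℝ (gradient φ (x + t • n)) n := hgc.inner continuous_const
  have hI := intervalIntegral.integral_eq_sub_of_hasDerivAt (a := 0) (b := s) (fun t _ => hd t)
    (hc.intervalIntegrable _ _)
  simp only [zero_smul, add_zero] at hI
  rw [← hI, intervalIntegral.integral_of_le hs.1]
  calc ‖∫ t in Ioc 0 s, inner ℝ (gradient φ (x + t • n)) n‖ₑ ^ 2
      ≤ (∫⁻ t in Ioc 0 τ, ‖gradient φ (x + t • n)‖ₑ * ‖n‖ₑ) ^ 2 := by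
        gcongr
        refine (enorm_integral_le_lintegral_enorm _).trans ?_
        refine (lintegral_mono fun t => ?_).trans (lintegral_mono_set (Ioc_subset_Ioc_right hs.2))
        rw [← ofReal_norm, ← ofReal_norm, ← ofReal_norm, ← ENNReal.ofReal_mul (norm_nonneg _)]
        exact ENNReal.ofReal_le_ofReal (norm_inner_le_norm _ _)
    _ ≤ _ := by
        refine (lintegral_sq_le _ (hgc.enorm.measurable.mul_const _).aemeasurable).trans
          (le_of_eq ?_)
        simp only [mul_pow]
        rw [lintegral_mul_const' _ _ (by simp)]
        simp only [Measure.restrict_apply_univ, Real.volume_Ioc, sub_zero]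
        ring

lemma setLIntegral_comp_add_le {A B : Set Plane} (hA : MeasurableSet A) (hB : MeasurableSet B)
    (v : Plane) (h : ∀ x ∈ A, x + v ∈ B) (g : Plane → ℝ≥0∞) :
    ∫⁻ x in A, g (x + v) ≤ ∫⁻ x in B, g x := by
  rw [← lintegral_indicator hA, ← lintegral_indicator hB,
    ← lintegral_add_right_eq_self (B.indicator g) v]
  refine lintegral_mono fun x => ?_
  by_cases hx : x ∈ A
  · simp [hx, h x hx]
  · simp [hx]

/-- If the segments from the points `x` of `A` to `x + v ∈ B` lie in `D`, then the `L²` norm over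
`A` is bounded by the one over `B` and that of the gradient over `D`. -/
lemma setLIntegral_sq_le_translate (hφ : ContDiff ℝ 1 φ) {A B D : Set Plane}
    (hA : MeasurableSet A) (hB : MeasurableSet B) (hD : MeasurableSet D) (v : Plane)
    (hAB : ∀ x ∈ A, x + v ∈ B) (hAD : ∀ x ∈ A, ∀ t ∈ Ioc (0 : ℝ) 1, x + t • v ∈ D) :
    ∫⁻ x in A, ‖φ x‖ₑ ^ 2 ≤
      2 * (∫⁻ x in B, ‖φ x‖ₑ ^ 2) + 2 * ‖v‖ₑ ^ 2 * ∫⁻ x in D, ‖gradient φ x‖ₑ ^ 2 := by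
  have hg := continuous_gradient hφ
  have hc := hφ.continuous
  have hgm : Measurable fun q : Plane × ℝ => ‖gradient φ (q.1 + q.2 • v)‖ₑ ^ 2 :=
    (hg.comp (by fun_prop : Continuous fun q : Plane × ℝ => q.1 + q.2 • v)).enorm.measurable.pow_const
      2
  have hφm : Measurable fun x => 2 * ‖φ (x + v)‖ₑ ^ 2 :=
    ((hc.comp (continuous_add_const v)).enorm.measurable.pow_const 2).const_mul 2
  have hpt : ∀ x, ‖φ x‖ₑ ^ 2 ≤ 2 * ‖φ (x + v)‖ₑ ^ 2 +
      2 * ‖v‖ₑ ^ 2 * ∫⁻ t in Ioc (0 : ℝ) 1, ‖gradient φ (x + t • v)‖ₑ ^ 2 := by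
    intro x
    refine (enorm_sq_le_two_mul (b := φ (x + v))).trans ?_
    rw [mul_assoc 2]
    gcongr
    have := enorm_sub_sq_le hφ x v (s := 1) (τ := 1) (by simp)
    rw [one_smul, ENNReal.ofReal_one, one_mul] at this
    rwa [← enorm_neg, neg_sub]
  calc ∫⁻ x in A, ‖φ x‖ₑ ^ 2
      ≤ ∫⁻ x in A, (2 * ‖φ (x + v)‖ₑ ^ 2 +
        2 * ‖v‖ₑ ^ 2 * ∫⁻ t in Ioc (0 : ℝ) 1, ‖gradient φ (x + t • v)‖ₑ ^ 2) :=
        lintegral_mono hpt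
    _ = 2 * (∫⁻ x in A, ‖φ (x + v)‖ₑ ^ 2) + 2 * ‖v‖ₑ ^ 2 *
          ∫⁻ x in A, ∫⁻ t in Ioc (0 : ℝ) 1, ‖gradient φ (x + t • v)‖ₑ ^ 2 := by
        rw [lintegral_add_left hφm, lintegral_const_mul' _ _ (by simp),
          lintegral_const_mul' _ _ (ENNReal.mul_ne_top (by simp) (by simp))]
    _ ≤ _ := by
        refine add_le_add (mul_le_mul_right ?_ _) (mul_le_mul_right ?_ _)
        · exact setLIntegral_comp_add_le hA hB v hAB fun x => ‖φ x‖ₑ ^ 2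
        -- After the swap, each fixed `t` is a translation by `t • v` that maps `A` into `D`.
        · rw [lintegral_lintegral_swap hgm.aemeasurable]
          calc ∫⁻ t in Ioc (0 : ℝ) 1, ∫⁻ x in A, ‖gradient φ (x + t • v)‖ₑ ^ 2
              ≤ ∫⁻ t in Ioc (0 : ℝ) 1, ∫⁻ x in D, ‖gradient φ x‖ₑ ^ 2 :=
                setLIntegral_mono measurable_const fun t ht => setLIntegral_comp_add_le hA hD
                  (t • v) (fun x hx => hAD x hx t ht) fun x => ‖gradient φ x‖ₑ ^ 2
            _ = _ := by simp

/-- The `L²` norm over `A` is bounded by the functional `E`. -/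
def Controlled (E : (Plane → ℝ) → ℝ≥0∞) (A : Set Plane) : Prop :=
  ∃ c : ℝ≥0, ∀ φ : Plane → ℝ, ContDiff ℝ 1 φ → ∫⁻ x in A, ‖φ x‖ₑ ^ 2 ≤ c * E φ

namespace Controlled

variable {E : (Plane → ℝ) → ℝ≥0∞} {A B D : Set Plane}

lemma mono (hB : Controlled E B) (h : A ⊆ B) : Controlled E A := by
  obtain ⟨c, hc⟩ := hB
  exact ⟨c, fun φ hφ => (lintegral_mono_set h).trans (hc φ hφ)⟩

lemma union (hA : Controlled E A) (hB : Controlled E B) : Controlled E (A ∪ B) := by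
  obtain ⟨a, ha⟩ := hA
  obtain ⟨b, hb⟩ := hB
  refine ⟨a + b, fun φ hφ => (lintegral_union_le _ _ _).trans ?_⟩
  rw [ENNReal.coe_add, add_mul]
  exact add_le_add (ha φ hφ) (hb φ hφ)

/-- Control passes to subsets and finite unions, so it is a local matter on compact sets.
Intersecting with `A` allows neighbourhoods of boundary points to be controlled only inside the
domain. -/
lemma of_isCompact {K : Set Plane} (hK : IsCompact K)
    (h : ∀ x ∈ K, ∃ U ∈ 𝓝 x, Controlled E (U ∩ A)) : Controlled E (K ∩ A) := by
  refine hK.induction_on (p := fun s => Controlled E (s ∩ A)) ⟨0, by simp⟩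
    (fun s t hst ht => ht.mono (inter_subset_inter_left _ hst))
    (fun s t hs ht => by rw [union_inter_distrib_right]; exact hs.union ht) fun x hx => ?_
  obtain ⟨U, hU, hc⟩ := h x hx
  exact ⟨U, mem_nhdsWithin_of_mem_nhds hU, hc⟩

/-- The means by which control moves from place to place: the gradient along the segments is paid
for by `E`, which dominates the Dirichlet energy on `D`. -/
lemma translate (hE : ∀ φ, ∫⁻ x in D, ‖gradient φ x‖ₑ ^ 2 ≤ E φ) (hA : MeasurableSet A)
    (hB : MeasurableSet B) (hD : MeasurableSet D) (v : Plane)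
    (hAB : ∀ x ∈ A, x + v ∈ B) (hAD : ∀ x ∈ A, ∀ t ∈ Ioc (0 : ℝ) 1, x + t • v ∈ D)
    (h : Controlled E B) : Controlled E A := by
  obtain ⟨c, hc⟩ := h
  refine ⟨2 * c + 2 * ‖v‖₊ ^ 2, fun φ hφ =>
    (setLIntegral_sq_le_translate hφ hA hB hD v hAB hAD).trans ?_⟩
  push_cast
  rw [add_mul, mul_assoc 2 (c : ℝ≥0∞)]
  gcongr
  · exact hc φ hφ
  · simp [enorm_eq_nnnorm]
  · exact hE φ

/-- Control propagates through a connected open set. -/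
lemma exists_nhds_of_isConnected (hE : ∀ φ, ∫⁻ x in D, ‖gradient φ x‖ₑ ^ 2 ≤ E φ) (hD : IsOpen D)
    (hconn : IsConnected D) {U : Set Plane} (hU : IsOpen U) (hUn : (D ∩ U).Nonempty)
    (hUc : Controlled E U) {x : Plane} (hx : x ∈ D) : ∃ V ∈ 𝓝 x, Controlled E V := by
  set W : Set Plane := {x | ∃ V ∈ 𝓝 x, Controlled E V} with hW
  have hWo : IsOpen W := by
    rw [isOpen_iff_mem_nhds]
    rintro y ⟨V, hV, hc⟩
    filter_upwards [eventually_mem_nhds_iff.2 hV] with z hz using ⟨V, hz, hc⟩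
  -- The set of points with a controlled neighbourhood is open; by connectedness it suffices that it
  -- is relatively closed in `D`.
  refine hconn.isPreconnected.subset_of_closure_inter_subset hWo ?_ ?_ hx
  · exact hUn.mono (inter_subset_inter_right _ fun y hy => ⟨U, hU.mem_nhds hy, hUc⟩)
  rintro y ⟨hy, hyD⟩
  obtain ⟨ε, hε, hball⟩ := Metric.isOpen_iff.1 hD y hyD
  obtain ⟨w, ⟨V, hV, hc⟩, hyw⟩ := Metric.mem_closure_iff.1 hy (ε / 2) (by positivity)
  obtain ⟨δ, hδ, hδV⟩ := Metric.mem_nhds_iff.1 hV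
  -- The bound `δ` makes the ball shifted from `y` to `w` land in the controlled ball; the bound `ε
  -- / 2` keeps the segments inside the `ε`-ball contained in `D`.
  refine ⟨Metric.ball y (min δ (ε / 2)), Metric.ball_mem_nhds _ (by positivity), ?_⟩
  refine translate (B := Metric.ball w δ) hE measurableSet_ball measurableSet_ball
    hD.measurableSet (w - y) (fun z hz => ?_) (fun z hz t ht => hball ?_) (hc.mono hδV)
  · rw [Metric.mem_ball, dist_eq_norm] at hz ⊢
    rw [show z + (w - y) - w = z - y by abel]
    exact hz.trans_le (min_le_left _ _)
  · rw [Metric.mem_ball, dist_eq_norm] at hz ⊢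
    rw [dist_comm, dist_eq_norm] at hyw
    calc ‖z + t • (w - y) - y‖ = ‖(z - y) + t • (w - y)‖ := by congr 1; abel
      _ ≤ ‖z - y‖ + ‖t • (w - y)‖ := norm_add_le _ _
      _ < ε / 2 + ε / 2 := by
        refine add_lt_add_of_lt_of_le (hz.trans_le (min_le_right _ _)) ?_
        rw [norm_smul, Real.norm_of_nonneg ht.1.le]
        nlinarith [norm_nonneg (w - y), ht.2]
      _ = ε := by ring

end Controlled

/-! ### Lipschitz charts and the trace inequality. -/

lemma exists_eq_add_pt (e : Plane ≃ₗᵢ[ℝ] Plane) (p x : Plane) :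
    p + e (pt ((e.symm (x - p)) 0) ((e.symm (x - p)) 1)) = x := by
  rw [pt_eta, LinearIsometryEquiv.apply_symm_apply, add_sub_cancel]

lemma isOpen_box (a b : ℝ) : IsOpen {q : ℝ × ℝ | |q.1| < a ∧ |q.2| < b} :=
  (isOpen_lt continuous_fst.abs continuous_const).and
    (isOpen_lt continuous_snd.abs continuous_const)

lemma symm_add_pt_sub (e : Plane ≃ₗᵢ[ℝ] Plane) (p : Plane) (s t : ℝ) :
    e.symm (p + e (pt s t) - p) = pt s t := by
  simp

lemma isOpen_preimage_chart (e : Plane ≃ₗᵢ[ℝ] Plane) (p : Plane) {O : Set (ℝ × ℝ)} (hO : IsOpen O) :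
    IsOpen {x : Plane | ((e.symm (x - p)) 0, (e.symm (x - p)) 1) ∈ O} := by
  have h : Continuous fun x : Plane => e.symm (x - p) := e.symm.continuous.comp (by fun_prop)
  exact hO.preimage (by fun_prop)

/-- A boundary chart in which the boundary stays away from the top and the bottom of the box. -/
lemma exists_chart {D : Set Plane} (hD : IsOpen D) (hL : HasLipschitzBoundary D) {p : Plane}
    (hp : p ∈ frontier D) :
    ∃ (e : Plane ≃ₗᵢ[ℝ] Plane) (a τ : ℝ) (K : ℝ≥0) (ψ : ℝ → ℝ), 0 < a ∧ 0 < τ ∧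
      LipschitzWith K ψ ∧ ψ 0 = 0 ∧ (∀ s, |s| ≤ a → |ψ s| ≤ τ) ∧
      (∀ s t, |s| ≤ a → |t| ≤ 3 * τ → (p + e (pt s t) ∈ D ↔ ψ s < t)) ∧
      ∀ s t, |s| < a → |t| < 2 * τ → p + e (pt s t) ∈ frontier D → t = ψ s := by
  obtain ⟨e, r, h, K, ψ, hr, hh, hψ, hψh, hiff⟩ := hL p hp
  -- Below the graph the box contains an open set disjoint from `D`; above it the points lie in the
  -- open set `D`. So boundary points in the box are on the graph.
  have hfr : ∀ s t, |s| < r → |t| < h → p + e (pt s t) ∈ frontier D → t = ψ s := by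
    intro s t hs ht hx
    rw [hD.frontier_eq] at hx
    by_contra hne
    rcases lt_or_gt_of_ne hne with hlt | hgt
    · set O : Set (ℝ × ℝ) := {q | |q.1| < r ∧ |q.2| < h ∧ q.2 < ψ q.1} with hO
      have hOo : IsOpen O := by
        have h1 := (isOpen_box r h).and
          (isOpen_lt continuous_snd (hψ.continuous.comp continuous_fst))
        simpa only [and_assoc, Function.comp_apply] using h1
      obtain ⟨y, hy, hyD⟩ := mem_closure_iff.1 hx.1 _ (isOpen_preimage_chart e p hOo)
        (by simp only [mem_ofPred_eq, symm_add_pt_sub, pt_zero, pt_one]; exact ⟨hs, ht, hlt⟩)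
      have := (hiff _ _ hy.1 hy.2.1).1 (by rwa [exists_eq_add_pt])
      exact lt_asymm this hy.2.2
    · exact hx.2 ((hiff s t hs ht).2 hgt)
  have hψ0 : ψ 0 = 0 := by
    refine (hfr 0 0 (by simpa) (by simpa) ?_).symm
    have : pt 0 0 = 0 := by ext i; fin_cases i <;> simp
    simpa [this] using hp
  obtain ⟨δ, hδ, hδψ⟩ := Metric.continuousAt_iff.1 (hψ.continuous.continuousAt (x := 0)) (h / 4)
    (by positivity)
  -- With `τ = h / 4` and `|ψ| ≤ τ`, a point of height below `2τ` can be raised by `τ` and still be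
  -- in the box, of half-height `4τ`.
  refine ⟨e, min (r / 2) (δ / 2), h / 4, K, ψ, by positivity, by positivity, hψ, hψ0,
    fun s hs => ?_, fun s t hs ht => ?_, fun s t hs ht => ?_⟩
  · have h1 := hs.trans (min_le_right _ _)
    have h2 := hδψ (x := s) (by rw [Real.dist_eq, sub_zero]; linarith)
    rw [hψ0, Real.dist_eq, sub_zero] at h2
    exact h2.le
  · have h1 := hs.trans (min_le_left _ _)
    exact hiff s t (by linarith) (by linarith)
  · have h1 := hs.trans_le (min_le_left _ _)
    exact hfr s t (by linarith) (by linarith)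

/-- Near a boundary point a Lipschitz domain can be shifted into a compact part of itself. -/
lemma exists_inward_shift {D : Set Plane} (hD : IsOpen D) (hL : HasLipschitzBoundary D) {p : Plane}
    (hp : p ∈ frontier D) :
    ∃ (U K : Set Plane) (v : Plane), IsOpen U ∧ p ∈ U ∧ IsCompact K ∧ K ⊆ D ∧
      ∀ x ∈ U ∩ D, x + v ∈ K ∧ ∀ t ∈ Ioc (0 : ℝ) 1, x + t • v ∈ D := by
  obtain ⟨e, a, τ, k, ψ, ha, hτ, hψ, -, hψτ, hiff, -⟩ := exists_chart hD hL hp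
  set O : Set (ℝ × ℝ) := {q | |q.1| < a ∧ |q.2| < 2 * τ}
  have hO : IsOpen O := isOpen_box _ _
  -- The compact part is what lies at least `τ` above the graph, which is where raising points of
  -- `D` by `τ` leads.
  set Q : Set (ℝ × ℝ) := (Icc (-a) a ×ˢ Icc (-(3 * τ)) (3 * τ)) ∩ {q | ψ q.1 + τ ≤ q.2}
  have hQ : IsCompact Q := (isCompact_Icc.prod isCompact_Icc).inter_right
    (isClosed_le (by have := hψ.continuous; fun_prop) (by fun_prop))
  have hc : Continuous fun q : ℝ × ℝ => p + e (pt q.1 q.2) :=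
    continuous_const.add (e.continuous.comp continuous_pt)
  refine ⟨_, (fun q : ℝ × ℝ => p + e (pt q.1 q.2)) '' Q, e (pt 0 τ), isOpen_preimage_chart e p hO,
    ?_, hQ.image hc, ?_, ?_⟩
  · simp [O, ha, hτ]
  · rintro _ ⟨⟨s, t⟩, ⟨⟨hs, ht⟩, hst⟩, rfl⟩
    have hst' : ψ s + τ ≤ t := hst
    exact (hiff s t (abs_le.2 hs) (abs_le.2 ht)).2 (by linarith)
  · rintro x ⟨⟨hs, ht⟩, hxD⟩
    set s := (e.symm (x - p)) 0
    set t := (e.symm (x - p)) 1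
    have hx : x = p + e (pt s t) := (exists_eq_add_pt e p x).symm
    have hs' : |s| < a := hs
    have ht' : |t| < 2 * τ := ht
    have ht'' := abs_lt.1 ht'
    have hlt : ψ s < t := (hiff s t hs'.le (by linarith)).1 (by rwa [← hx])
    have hadd : ∀ c : ℝ, x + c • e (pt 0 τ) = p + e (pt s (t + c * τ)) := by
      intro c
      rw [hx, ← map_smul, smul_pt, add_assoc, ← map_add, pt_add, mul_zero, add_zero]
    refine ⟨⟨(s, t + τ), ⟨⟨abs_le.1 hs'.le, ?_, ?_⟩, ?_⟩, ?_⟩, fun c hc => ?_⟩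
    · simp only; linarith
    · simp only; linarith
    · change ψ s + τ ≤ t + τ
      linarith
    · have := hadd 1
      rw [one_smul, one_mul] at this
      exact this.symm
    · rw [hadd]
      have h1 : 0 < c * τ := mul_pos hc.1 hτ
      have h2 : c * τ ≤ τ := by nlinarith [hc.2]
      exact (hiff s _ hs'.le (abs_le.2 ⟨by linarith, by linarith⟩)).2 (by linarith)

/-- A Lipschitz map enlarges length at most by its constant. Only upper bounds are needed, so this
replaces the arc length formula for the graph. -/
lemma arc_restrict_le_map {g : ℝ → Plane} {c : ℝ≥0} (hg : LipschitzWith c g) {S : Set Plane}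
    {I : Set ℝ} (h : S ⊆ g '' I) :
    arc.restrict S ≤ c • (volume.restrict I).map g := by
  refine Measure.le_iff.2 fun A hA => ?_
  have hm := hg.continuous.measurable
  rw [Measure.restrict_apply hA, Measure.smul_apply, Measure.map_apply hm hA,
    Measure.restrict_apply (hm hA)]
  have h1 : A ∩ S ⊆ g '' (g ⁻¹' A ∩ I) := by
    rintro x ⟨hxA, hxS⟩
    obtain ⟨s, hs, rfl⟩ := h hxS
    exact ⟨s, ⟨hxA, hs⟩, rfl⟩
  have h2 := hg.hausdorffMeasure_image_le zero_le_one (g ⁻¹' A ∩ I)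
  rw [hausdorffMeasure_real, ENNReal.rpow_one] at h2
  exact (measure_mono h1).trans h2

lemma lipschitzWith_graph (e : Plane ≃ₗᵢ[ℝ] Plane) (p : Plane) {K : ℝ≥0} {ψ : ℝ → ℝ}
    (hψ : LipschitzWith K ψ) : LipschitzWith (1 + K) fun s => p + e (pt s (ψ s)) := by
  refine LipschitzWith.of_dist_le_mul fun s s' => ?_
  rw [dist_add_left, e.dist_map, EuclideanSpace.dist_eq, Fin.sum_univ_two]
  simp only [pt_zero, pt_one]
  have h := hψ.dist_le_mul s s'
  refine Real.sqrt_le_iff.2 ⟨by positivity, ?_⟩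
  push_cast
  have h0 : 0 ≤ dist s s' := dist_nonneg
  have h1 : 0 ≤ dist (ψ s) (ψ s') := dist_nonneg
  have hK : 0 ≤ (K : ℝ) := K.2
  have h2 : dist (ψ s) (ψ s') ^ 2 ≤ (K * dist s s') ^ 2 := by gcongr
  have h3 : 0 ≤ K * dist s s' ^ 2 := by positivity
  nlinarith

/-- Tonelli's theorem for the strip above a graph. -/
lemma lintegral_strip_le {D : Set Plane} (hD : MeasurableSet D) (e : Plane ≃ₗᵢ[ℝ] Plane)
    (p : Plane) {τ : ℝ} {I : Set ℝ} (hI : MeasurableSet I) {ψ : ℝ → ℝ}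
    (h : ∀ s ∈ I, ∀ t ∈ Ioc 0 τ, p + e (pt s (ψ s + t)) ∈ D) {f : Plane → ℝ≥0∞}
    (hf : Measurable f) :
    ∫⁻ s in I, ∫⁻ t in Ioc 0 τ, f (p + e (pt s (ψ s + t))) ≤ ∫⁻ x in D, f x := by
  have hfm : Measurable (D.indicator f) := hf.indicator hD
  have hem : MeasurePreserving (fun x : Plane => p + e x) :=
    (measurePreserving_add_left volume p).comp e.measurePreserving
  calc ∫⁻ s in I, ∫⁻ t in Ioc 0 τ, f (p + e (pt s (ψ s + t)))
      ≤ ∫⁻ s in I, ∫⁻ t, D.indicator f (p + e (pt s t)) := by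
        refine setLIntegral_mono' hI fun s hs => ?_
        -- Translating `t` by `ψ s` straightens the strip; the remaining change of variables is a
        -- rigid motion.
        rw [← lintegral_add_left_eq_self (fun t => D.indicator f (p + e (pt s t))) (ψ s),
          ← lintegral_indicator measurableSet_Ioc]
        refine lintegral_mono fun t => ?_
        by_cases ht : t ∈ Ioc 0 τ
        · simp only [indicator_of_mem ht, indicator_of_mem (h s hs t ht), le_refl]
        · simp [ht]
    _ ≤ ∫⁻ s, ∫⁻ t, D.indicator f (p + e (pt s t)) := setLIntegral_le_lintegral _ _
    _ = ∫⁻ x in D, f x := by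
        rw [← lintegral_plane (f := fun x => D.indicator f (p + e x)) (hfm.comp hem.measurable),
          hem.lintegral_comp hfm, lintegral_indicator hD]

/-- Local form of the trace inequality. -/
lemma exists_local_trace_bound {D : Set Plane} (hD : IsOpen D) (hL : HasLipschitzBoundary D)
    {p : Plane} (hp : p ∈ frontier D) :
    ∃ U ∈ 𝓝 p, ∃ c : ℝ≥0, ∀ φ : Plane → ℝ, ContDiff ℝ 1 φ →
      ∫⁻ x in U ∩ frontier D, ‖φ x‖ₑ ^ 2 ∂arc ≤
        c * ((∫⁻ x in D, ‖φ x‖ₑ ^ 2) + ∫⁻ x in D, ‖gradient φ x‖ₑ ^ 2) := by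
  obtain ⟨e, a, τ, k, ψ, ha, hτ, hψ, hψ0, hψτ, hiff, hfr⟩ := exists_chart hD hL hp
  set O : Set (ℝ × ℝ) := {q | |q.1| < a ∧ |q.2| < 2 * τ}
  have hO : IsOpen O := isOpen_box _ _
  set U : Set Plane := {x | ((e.symm (x - p)) 0, (e.symm (x - p)) 1) ∈ O}
  set g : ℝ → Plane := fun s => p + e (pt s (ψ s)) with hg
  have hgL : LipschitzWith (1 + k) g := lipschitzWith_graph e p hψ
  have hsub : U ∩ frontier D ⊆ g '' Ioo (-a) a := by
    rintro x ⟨⟨hs, ht⟩, hx⟩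
    have := hfr _ _ hs ht (by rwa [exists_eq_add_pt])
    refine ⟨_, abs_lt.1 hs, ?_⟩
    simp only [hg]
    rw [← this, exists_eq_add_pt]
  set n : Plane := e (pt 0 1)
  have hgn : ∀ s t : ℝ, g s + t • n = p + e (pt s (ψ s + t)) := by
    intro s t
    simp only [hg, n]
    rw [← map_smul, smul_pt, add_assoc, ← map_add, pt_add, mul_zero, add_zero, mul_one]
  have hin : ∀ s ∈ Ioo (-a) a, ∀ t ∈ Ioc 0 τ, p + e (pt s (ψ s + t)) ∈ D := by
    intro s hs t ht
    have hs' := (abs_lt.2 hs).le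
    have := abs_le.1 (hψτ s hs')
    exact (hiff s _ hs' (abs_le.2 ⟨by linarith [ht.1], by linarith [ht.2]⟩)).2 (by linarith [ht.1])
  refine ⟨U, (isOpen_preimage_chart e p hO).mem_nhds (by simp [O, ha, hτ]),
    (1 + k) * ((τ.toNNReal)⁻¹ * (2 + 2 * τ.toNNReal ^ 2 * ‖n‖₊ ^ 2)), fun φ hφ => ?_⟩
  have hgr := continuous_gradient hφ
  set T : ℝ≥0∞ := ENNReal.ofReal τ
  have hT0 : T ≠ 0 := by simpa [T] using hτ
  have hTt : T ≠ ⊤ := ENNReal.ofReal_ne_top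
  -- The boundary value is compared with the value at each depth `t` in `(0, τ]`, and the comparison
  -- is integrated over `t`; this gives the factor `T` on the left.
  have hpt : ∀ x : Plane, T * ‖φ x‖ₑ ^ 2 ≤ 2 * (∫⁻ t in Ioc 0 τ, ‖φ (x + t • n)‖ₑ ^ 2) +
      2 * T ^ 2 * ‖n‖ₑ ^ 2 * ∫⁻ t in Ioc 0 τ, ‖gradient φ (x + t • n)‖ₑ ^ 2 := by
    intro x
    set J := ∫⁻ t in Ioc 0 τ, ‖gradient φ (x + t • n)‖ₑ ^ 2
    have h1 : ∫⁻ _t in Ioc 0 τ, ‖φ x‖ₑ ^ 2 ≤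
        ∫⁻ t in Ioc 0 τ, (2 * ‖φ (x + t • n)‖ₑ ^ 2 + 2 * (T * ‖n‖ₑ ^ 2 * J)) := by
      refine setLIntegral_mono' measurableSet_Ioc fun t ht => ?_
      refine (enorm_sq_le_two_mul (b := φ (x + t • n))).trans ?_
      gcongr
      rw [← enorm_neg, neg_sub]
      exact enorm_sub_sq_le hφ x n (Ioc_subset_Icc_self ht)
    rw [lintegral_add_right _ measurable_const, lintegral_const_mul' _ _ (by simp)] at h1
    simp only [lintegral_const, Measure.restrict_apply_univ, Real.volume_Ioc, sub_zero] at h1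
    rw [mul_comm]
    refine h1.trans (le_of_eq ?_)
    ring
  have hcont : Continuous g := hgL.continuous
  have hφm : Measurable fun x => ‖φ x‖ₑ ^ 2 := hφ.continuous.enorm.measurable.pow_const 2
  have hgm : Measurable fun x => ‖gradient φ x‖ₑ ^ 2 := hgr.enorm.measurable.pow_const 2
  have hmeas : Measurable fun s => ∫⁻ t in Ioc 0 τ, ‖φ (g s + t • n)‖ₑ ^ 2 := by
    refine Measurable.lintegral_prod_right' (f := fun q : ℝ × ℝ => ‖φ (g q.1 + q.2 • n)‖ₑ ^ 2) ?_
    exact hφm.comp (by fun_prop : Continuous fun q : ℝ × ℝ => g q.1 + q.2 • n).measurable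
  have hline : ∫⁻ s in Ioo (-a) a, ‖φ (g s)‖ₑ ^ 2 ≤ T⁻¹ * (2 * (∫⁻ x in D, ‖φ x‖ₑ ^ 2) +
      2 * T ^ 2 * ‖n‖ₑ ^ 2 * ∫⁻ x in D, ‖gradient φ x‖ₑ ^ 2) := by
    rw [mul_comm T⁻¹, ← div_eq_mul_inv, ENNReal.le_div_iff_mul_le (.inl hT0) (.inl hTt), mul_comm,
      ← lintegral_const_mul' _ _ hTt]
    refine (lintegral_mono fun s => hpt (g s)).trans ?_
    rw [lintegral_add_left (hmeas.const_mul 2), lintegral_const_mul' _ _ (by simp),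
      lintegral_const_mul' _ _ (ENNReal.mul_ne_top (by finiteness) (by simp))]
    simp only [hgn]
    gcongr
    · exact lintegral_strip_le hD.measurableSet e p measurableSet_Ioo hin hφm
    · exact lintegral_strip_le hD.measurableSet e p measurableSet_Ioo hin hgm
  calc ∫⁻ x in U ∩ frontier D, ‖φ x‖ₑ ^ 2 ∂arc
      ≤ ∫⁻ x, ‖φ x‖ₑ ^ 2 ∂((1 + k) • (volume.restrict (Ioo (-a) a)).map g) :=
        lintegral_mono' (arc_restrict_le_map hgL hsub) le_rfl
    _ = (1 + k : ℝ≥0) * ∫⁻ s in Ioo (-a) a, ‖φ (g s)‖ₑ ^ 2 := by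
        rw [lintegral_smul_measure, lintegral_map hφm hcont.measurable]
        rfl
    _ ≤ (1 + k : ℝ≥0) * (T⁻¹ * (2 * (∫⁻ x in D, ‖φ x‖ₑ ^ 2) +
      2 * T ^ 2 * ‖n‖ₑ ^ 2 * ∫⁻ x in D, ‖gradient φ x‖ₑ ^ 2)) := by gcongr
    _ ≤ _ := by
        have hτ0 : τ.toNNReal ≠ 0 := by simpa using hτ
        have hTc : ((τ.toNNReal : ℝ≥0) : ℝ≥0∞) = T := rfl
        set N := ∫⁻ x in D, ‖φ x‖ₑ ^ 2
        set M := ∫⁻ x in D, ‖gradient φ x‖ₑ ^ 2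
        push_cast [ENNReal.coe_inv hτ0]
        rw [hTc, ← enorm_eq_nnnorm n, mul_assoc (1 + (k : ℝ≥0∞)), mul_assoc T⁻¹]
        refine mul_le_mul_right (mul_le_mul_right ?_ _) _
        rw [add_mul]
        exact add_le_add (mul_le_mul_right le_self_add _) (mul_le_mul_right le_add_self _)

/-- A Poincaré type inequality: control on one open piece of a bounded connected Lipschitz domain
gives control on all of it. -/
lemma Controlled.of_isConnected {E : (Plane → ℝ) → ℝ≥0∞} {D : Set Plane}
    (hE : ∀ φ, ∫⁻ x in D, ‖gradient φ x‖ₑ ^ 2 ≤ E φ) (hD : IsOpen D)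
    (hb : Bornology.IsBounded D) (hL : HasLipschitzBoundary D)
    (hconn : IsConnected D) {U : Set Plane} (hU : IsOpen U) (hUn : (D ∩ U).Nonempty)
    (hUc : Controlled E U) : Controlled E D := by
  have hint : ∀ x ∈ D, ∃ V ∈ 𝓝 x, Controlled E V := fun x hx =>
    Controlled.exists_nhds_of_isConnected hE hD hconn hU hUn hUc hx
  have hcl : IsCompact (closure D) := hb.isCompact_closure
  refine (Controlled.of_isCompact (A := D) hcl fun x hx => ?_).mono
    (subset_inter subset_closure subset_rfl)
  by_cases hxD : x ∈ D
  · obtain ⟨V, hV, hc⟩ := hint x hxD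
    exact ⟨V, hV, hc.mono inter_subset_left⟩
  -- Near the boundary, the points of `D` are shifted into a compact subset of `D`, where control is
  -- already known.
  · obtain ⟨V, K, v, hV, hxV, hK, hKD, hVK⟩ := exists_inward_shift hD hL
      (by rw [hD.frontier_eq]; exact ⟨hx, hxD⟩ : x ∈ frontier D)
    have hKc : Controlled E (K ∩ univ) := Controlled.of_isCompact hK fun y hy => by
      simpa using hint y (hKD hy)
    rw [inter_univ] at hKc
    exact ⟨V, hV.mem_nhds hxV, hKc.translate hE (hV.inter hD).measurableSet hK.measurableSet
      hD.measurableSet v (fun y hy => (hVK y hy).1) fun y hy => (hVK y hy).2⟩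

/-- The trace inequality for bounded Lipschitz domains. -/
lemma exists_trace_bound {D : Set Plane} (hD : IsOpen D) (hb : Bornology.IsBounded D)
    (hL : HasLipschitzBoundary D) :
    ∃ c : ℝ≥0, ∀ φ : Plane → ℝ, ContDiff ℝ 1 φ →
      ∫⁻ x in frontier D, ‖φ x‖ₑ ^ 2 ∂arc ≤
        c * ((∫⁻ x in D, ‖φ x‖ₑ ^ 2) + ∫⁻ x in D, ‖gradient φ x‖ₑ ^ 2) := by
  have hcomp : IsCompact (frontier D) :=
    hb.isCompact_closure.of_isClosed_subset isClosed_frontier frontier_subset_closure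
  have := hcomp.induction_on (p := fun s => ∃ c : ℝ≥0, ∀ φ : Plane → ℝ, ContDiff ℝ 1 φ →
      ∫⁻ x in s ∩ frontier D, ‖φ x‖ₑ ^ 2 ∂arc ≤
        c * ((∫⁻ x in D, ‖φ x‖ₑ ^ 2) + ∫⁻ x in D, ‖gradient φ x‖ₑ ^ 2)) ⟨0, by simp⟩
    (fun s t hst ⟨c, hc⟩ => ⟨c, fun φ hφ =>
      (lintegral_mono_set (inter_subset_inter_left _ hst)).trans (hc φ hφ)⟩)
    (fun s t ⟨c, hc⟩ ⟨d, hd⟩ => ⟨c + d, fun φ hφ => by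
      rw [union_inter_distrib_right, ENNReal.coe_add, add_mul]
      exact (lintegral_union_le _ _ _).trans (add_le_add (hc φ hφ) (hd φ hφ))⟩)
    (fun x hx => by
      obtain ⟨U, hU, hc⟩ := exists_local_trace_bound hD hL hx
      exact ⟨U, mem_nhdsWithin_of_mem_nhds hU, hc⟩)
  simpa using this

/-! ### The Poincaré–Friedrichs inequality on `Ω₂`. -/

namespace Geometry

variable (G : Geometry)

lemma isOpen_Ω₂ : IsOpen G.Ω₂ := G.isOpen.inter (isOpen_lt continuous_const (by fun_prop))

lemma isBounded_Ω₂ : Bornology.IsBounded G.Ω₂ := G.bounded.subset inter_subset_left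

lemma volume_Ω₂_lt_top : volume G.Ω₂ < ⊤ := G.isBounded_Ω₂.measure_lt_top

lemma mem_Ω₂_iff {p : Plane} (hp : p 0 < G.L₂) :
    p ∈ G.Ω₂ ↔ G.L₀ < p 0 ∧ 0 < p 1 ∧ p 1 < G.H := by
  have h0 := G.L₀_pos
  simp only [Ω₂, mem_inter_iff, G.thin p hp, mem_ofPred_eq]
  constructor
  · rintro ⟨⟨-, h⟩, h'⟩; exact ⟨h', h⟩
  · rintro ⟨h', h⟩; exact ⟨⟨h0.trans h', h⟩, h'⟩

lemma Γ_subset_Ω : G.Γ ⊆ G.Ω := fun p hp =>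
  (G.thin p (hp.1.trans_lt G.L₀_lt)).2 ⟨by rw [hp.1]; exact G.L₀_pos, hp.2⟩

lemma Γ_subset_frontier : G.Γ ⊆ frontier G.Ω₂ := by
  intro p hp
  rw [G.isOpen_Ω₂.frontier_eq]
  refine ⟨?_, fun h => (lt_irrefl _ (hp.1 ▸ h.2 : G.L₀ < G.L₀))⟩
  have hlim : Tendsto (fun s : ℝ => pt (p 0 + s) (p 1)) (𝓝[>] 0) (𝓝 p) := by
    have : Continuous fun s : ℝ => pt (p 0 + s) (p 1) :=
      continuous_pt.comp (by fun_prop : Continuous fun s : ℝ => (p 0 + s, p 1))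
    have h := this.tendsto 0
    rw [add_zero, pt_eta] at h
    exact h.mono_left nhdsWithin_le_nhds
  refine mem_closure_of_tendsto hlim ?_
  filter_upwards [Ioo_mem_nhdsGT (sub_pos.2 G.L₀_lt)] with s hs
  rw [mem_Ω₂_iff]
  · simpa [hp.1, hp.2.1, hp.2.2] using hs.1
  · have := hs.2
    simp only [pt_zero, hp.1]; linarith

/-- This is the trace inequality for the constant function `1`. -/
lemma arc_frontier_lt_top : arc (frontier G.Ω₂) < ⊤ := by
  obtain ⟨c, hc⟩ := exists_trace_bound G.isOpen_Ω₂ G.isBounded_Ω₂ G.lipschitz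
  have h := hc (fun _ => 1) contDiff_const
  have hg : gradient (fun _ : Plane => (1 : ℝ)) = fun _ => 0 := by ext1 x; simp [gradient]
  simp only [hg, enorm_one, one_pow, lintegral_one, Measure.restrict_apply_univ, enorm_zero] at h
  refine h.trans_lt (ENNReal.mul_lt_top (by simp) ?_)
  simpa using G.volume_Ω₂_lt_top

/-- The Dirichlet energy on `Ω₂` plus the square of the `L²` norm on the interface. -/
def energy (φ : Plane → ℝ) : ℝ≥0∞ :=
  (∫⁻ x in G.Ω₂, ‖gradient φ x‖ₑ ^ 2) + ∫⁻ x in G.Γ, ‖φ x‖ₑ ^ 2 ∂arc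

/-- Horizontal segments issuing from `Γ` sweep out this rectangle, so values there are those on `Γ`
plus an integral of the gradient. It is the seed from which control spreads over `Ω₂`. -/
lemma controlled_near_interface :
    Controlled G.energy {p | (G.L₀ < p 0 ∧ p 0 < G.L₂) ∧ 0 < p 1 ∧ p 1 < G.H} := by
  set R : Set Plane := {p | (G.L₀ < p 0 ∧ p 0 < G.L₂) ∧ 0 < p 1 ∧ p 1 < G.H} with hR
  set τ : ℝ := G.L₂ - G.L₀ with hτ
  have hτ0 : 0 < τ := sub_pos.2 G.L₀_lt
  set T : ℝ≥0∞ := ENNReal.ofReal τ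
  have h0 : Measurable fun p : Plane => p 0 := by fun_prop
  have h1 : Measurable fun p : Plane => p 1 := by fun_prop
  have hRm : MeasurableSet R :=
    ((measurableSet_lt measurable_const h0).inter (measurableSet_lt h0 measurable_const)).inter
      ((measurableSet_lt measurable_const h1).inter (measurableSet_lt h1 measurable_const))
  have hRsub : R ⊆ G.Ω₂ := fun p hp => (G.mem_Ω₂_iff hp.1.2).2 ⟨hp.1.1, hp.2⟩
  have hfub : ∀ f : Plane → ℝ≥0∞, Measurable f → ∫⁻ p in R, f p =
      ∫⁻ z in Ioo 0 G.H, ∫⁻ t in Ioo 0 τ, f (pt G.L₀ z + t • pt 1 0) := by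
    intro f hf
    rw [← lintegral_indicator hRm, lintegral_plane_symm (hf.indicator hRm),
      ← lintegral_indicator measurableSet_Ioo]
    refine lintegral_congr fun z => ?_
    by_cases hz : z ∈ Ioo 0 G.H
    · rw [indicator_of_mem hz, ← lintegral_indicator measurableSet_Ioo,
        ← lintegral_add_left_eq_self _ G.L₀]
      refine lintegral_congr fun t => ?_
      simp only [smul_pt, pt_add, mul_one, mul_zero, add_zero]
      by_cases ht : t ∈ Ioo 0 τ
      · rw [indicator_of_mem ht, indicator_of_mem]
        simp only [hR, mem_ofPred_eq, pt_zero, pt_one]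
        exact ⟨⟨by linarith [ht.1], by linarith [ht.2]⟩, hz⟩
      · rw [indicator_of_notMem ht, indicator_of_notMem]
        simp only [hR, mem_ofPred_eq, pt_zero, pt_one]
        exact fun h => ht ⟨by linarith [h.1.1], by linarith [h.1.2]⟩
    · rw [indicator_of_notMem hz]
      have : ∀ x, R.indicator f (pt x z) = 0 := fun x => indicator_of_notMem (by
        simp only [hR, mem_ofPred_eq, pt_zero, pt_one]
        exact fun h => hz h.2) _
      simp [this]
  refine ⟨2 * τ.toNNReal + 2 * τ.toNNReal ^ 2, fun φ hφ => ?_⟩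
  have hφm : Measurable fun x => ‖φ x‖ₑ ^ 2 := hφ.continuous.enorm.measurable.pow_const 2
  have hgm : Measurable fun x => ‖gradient φ x‖ₑ ^ 2 :=
    (continuous_gradient hφ).enorm.measurable.pow_const 2
  have hn : ‖pt 1 0‖ₑ = 1 := by
    have := norm_pt_sq 1 0
    have h : ‖pt 1 0‖ = 1 := by nlinarith [norm_nonneg (pt 1 0)]
    rw [← ofReal_norm, h, ENNReal.ofReal_one]
  have hline : ∀ z, ∫⁻ t in Ioo 0 τ, ‖φ (pt G.L₀ z + t • pt 1 0)‖ₑ ^ 2 ≤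
      2 * T * ‖φ (pt G.L₀ z)‖ₑ ^ 2 +
        2 * T ^ 2 * ∫⁻ t in Ioo 0 τ, ‖gradient φ (pt G.L₀ z + t • pt 1 0)‖ₑ ^ 2 := by
    intro z
    set J := ∫⁻ t in Ioo 0 τ, ‖gradient φ (pt G.L₀ z + t • pt 1 0)‖ₑ ^ 2 with hJ
    calc ∫⁻ t in Ioo 0 τ, ‖φ (pt G.L₀ z + t • pt 1 0)‖ₑ ^ 2
        ≤ ∫⁻ _t in Ioo 0 τ, (2 * ‖φ (pt G.L₀ z)‖ₑ ^ 2 + 2 * (T * J)) := by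
          refine setLIntegral_mono' measurableSet_Ioo fun t ht => ?_
          refine (enorm_sq_le_two_mul (b := φ (pt G.L₀ z))).trans ?_
          gcongr
          have := enorm_sub_sq_le hφ (pt G.L₀ z) (pt 1 0) (Ioo_subset_Icc_self ht)
          rwa [hn, one_pow, mul_one, setLIntegral_congr Ioo_ae_eq_Ioc.symm] at this
      _ = _ := by
          simp only [lintegral_const, Measure.restrict_apply_univ, Real.volume_Ioo, sub_zero]
          ring
  have hΓ : ∫⁻ z in Ioo 0 G.H, ‖φ (pt G.L₀ z)‖ₑ ^ 2 = ∫⁻ x in G.Γ, ‖φ x‖ₑ ^ 2 ∂arc := by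
    rw [arc_restrict_Γ, lintegral_map hφm G.measurableEmbedding_interface.measurable]
  have hTc : ((τ.toNNReal : ℝ≥0) : ℝ≥0∞) = T := rfl
  calc ∫⁻ p in R, ‖φ p‖ₑ ^ 2
      ≤ ∫⁻ z in Ioo 0 G.H, (2 * T * ‖φ (pt G.L₀ z)‖ₑ ^ 2 +
        2 * T ^ 2 * ∫⁻ t in Ioo 0 τ, ‖gradient φ (pt G.L₀ z + t • pt 1 0)‖ₑ ^ 2) := by
        rw [hfub _ hφm]
        exact lintegral_mono hline
    _ = 2 * T * (∫⁻ x in G.Γ, ‖φ x‖ₑ ^ 2 ∂arc) +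
        2 * T ^ 2 * ∫⁻ p in R, ‖gradient φ p‖ₑ ^ 2 := by
        rw [lintegral_add_left, lintegral_const_mul' _ _ (by finiteness),
          lintegral_const_mul' _ _ (by finiteness), hΓ, hfub _ hgm]
        exact (hφm.comp G.measurableEmbedding_interface.measurable).const_mul _
    _ ≤ 2 * T * G.energy φ + 2 * T ^ 2 * G.energy φ := by
        refine add_le_add (mul_le_mul_right le_add_self _) (mul_le_mul_right ?_ _)
        exact (lintegral_mono_set hRsub).trans le_self_add
    _ = _ := by
        push_cast
        rw [hTc]
        ring

/-- The Poincaré–Friedrichs inequality on `Ω₂`. -/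
lemma controlled_Ω₂ : Controlled G.energy G.Ω₂ := by
  have h0 : Continuous fun p : Plane => p 0 := by fun_prop
  have h1 : Continuous fun p : Plane => p 1 := by fun_prop
  refine Controlled.of_isConnected (fun φ => le_self_add) G.isOpen_Ω₂ G.isBounded_Ω₂ G.lipschitz
    G.connected (((isOpen_lt continuous_const h0).and (isOpen_lt h0 continuous_const)).and
      ((isOpen_lt continuous_const h1).and (isOpen_lt h1 continuous_const))) ?_
    G.controlled_near_interface
  have hL := G.L₀_lt
  have hH := G.H_pos
  have : pt ((G.L₀ + G.L₂) / 2) (G.H / 2) ∈ {p : Plane | (G.L₀ < p 0 ∧ p 0 < G.L₂) ∧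
      0 < p 1 ∧ p 1 < G.H} := by
    simp only [mem_ofPred_eq, pt_zero, pt_one]
    refine ⟨⟨?_, ?_⟩, ?_, ?_⟩ <;> linarith
  exact ⟨_, (G.mem_Ω₂_iff this.1.2).2 ⟨this.1.1, this.2⟩, this⟩

end Geometry

/-! ### `L²` norms and integration by parts. -/

section L2

variable {α E : Type*} [MeasurableSpace α] {μ : Measure α} [NormedAddCommGroup E]

lemma eLpNorm_two_sq (f : α → E) : eLpNorm f 2 μ ^ 2 = ∫⁻ a, ‖f a‖ₑ ^ 2 ∂μ := by
  have h := eLpNorm_nnreal_pow_eq_lintegral (μ := μ) (f := f) (p := 2) two_ne_zero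
  simpa using h

lemma Lp.enorm_sq_eq (f : Lp E 2 μ) : ‖f‖ₑ ^ 2 = ∫⁻ a, ‖f a‖ₑ ^ 2 ∂μ := by
  rw [Lp.enorm_def, eLpNorm_two_sq]

lemma inner_toLp [InnerProductSpace ℝ E] {f g : α → E} (hf : MemLp f 2 μ) (hg : MemLp g 2 μ) :
    inner ℝ (hf.toLp f) (hg.toLp g) = ∫ a, inner ℝ (f a) (g a) ∂μ := by
  rw [L2.inner_def]
  refine integral_congr_ae ?_
  filter_upwards [hf.coeFn_toLp, hg.coeFn_toLp] with a h1 h2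
  rw [h1, h2]

end L2

lemma memLp_of_continuous {E : Type*} [NormedAddCommGroup E] [SecondCountableTopology E]
    {f : Plane → E} (hf : Continuous f) {m : Measure Plane} {s : Set Plane}
    (hs : MeasurableSet s) (hb : Bornology.IsBounded s) (hm : m s < ⊤) :
    MemLp f 2 (m.restrict s) := by
  have : IsFiniteMeasure (m.restrict s) := ⟨by simpa using hm⟩
  obtain ⟨c, hc⟩ := hb.isCompact_closure.exists_bound_of_continuousOn hf.continuousOn
  refine MemLp.of_bound hf.aestronglyMeasurable c ?_
  filter_upwards [ae_restrict_mem hs] with x hx using hc x (subset_closure hx)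

lemma gradient_eq_zero_of_notMem {φ : Plane → ℝ} {x : Plane} (hx : x ∉ tsupport φ) :
    gradient φ x = 0 := by
  have h : fderiv ℝ φ x = 0 := by
    by_contra h
    exact hx (support_fderiv_subset ℝ (Function.mem_support.2 h))
  simp [gradient, h]

/-- Integration by parts against a test function. -/
lemma setIntegral_smul_gradient {D : Set Plane} {ψ φ : Plane → ℝ} (hψ : ContDiff ℝ 1 ψ)
    (hφ : ContDiff ℝ 1 φ) (hc : HasCompactSupport φ) (hs : tsupport φ ⊆ D) :
    ∫ p in D, ψ p • gradient φ p = - ∫ p in D, φ p • gradient ψ p := by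
  have hgφ := continuous_gradient hφ
  have hgψ := continuous_gradient hψ
  have hφ0 : ∀ x, x ∉ D → φ x = 0 := fun x hx => image_eq_zero_of_notMem_tsupport fun h => hx (hs h)
  have hcg : HasCompactSupport (gradient φ) :=
    HasCompactSupport.intro hc fun x hx => gradient_eq_zero_of_notMem hx
  rw [setIntegral_eq_integral_of_forall_compl_eq_zero (fun x hx => by
      rw [gradient_eq_zero_of_notMem fun h => hx (hs h), smul_zero]),
    setIntegral_eq_integral_of_forall_compl_eq_zero (fun x hx => by rw [hφ0 x hx, zero_smul])]
  have i1 : Integrable fun p => ψ p • gradient φ p :=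
    (hψ.continuous.smul hgφ).integrable_of_hasCompactSupport hcg.smul_left
  have i2 : Integrable fun p => φ p • gradient ψ p :=
    (hφ.continuous.smul hgψ).integrable_of_hasCompactSupport hc.smul_right
  refine ext_inner_left ℝ fun v => ?_
  rw [inner_neg_right, ← integral_inner i1, ← integral_inner i2]
  have e1 : ∀ p, inner ℝ v (ψ p • gradient φ p) = ψ p * fderiv ℝ φ p v := fun p => by
    rw [inner_smul_right, real_inner_comm, inner_gradient_left]
  have e2 : ∀ p, inner ℝ v (φ p • gradient ψ p) = fderiv ℝ ψ p v * φ p := fun p => by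
    rw [inner_smul_right, real_inner_comm, inner_gradient_left, mul_comm]
  have j1 := i1.const_inner (𝕜 := ℝ) v
  have j2 := i2.const_inner (𝕜 := ℝ) v
  simp only [e1, e2] at j1 j2 ⊢
  refine integral_mul_fderiv_eq_neg_fderiv_mul_of_integrable j2 j1 ?_
    (fun x _ => hψ.differentiable one_ne_zero x) (fun x _ => hφ.differentiable one_ne_zero x)
  exact (hψ.continuous.mul hφ.continuous).integrable_of_hasCompactSupport hc.mul_left

/-! ### `H¹` functions with traces as a closed subspace of a Hilbert space. -/

namespace Geometry

variable (G : Geometry)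

/-- Lebesgue measure on `Ω₂`. -/
abbrev vol : Measure Plane := volume.restrict G.Ω₂

/-- Arc length on `∂Ω₂`. -/
abbrev bdry : Measure Plane := arc.restrict (frontier G.Ω₂)

instance : IsFiniteMeasure G.vol := ⟨by simpa using G.volume_Ω₂_lt_top⟩

instance : IsFiniteMeasure G.bdry := ⟨by simpa using G.arc_frontier_lt_top⟩

lemma isBounded_frontier : Bornology.IsBounded (frontier G.Ω₂) :=
  G.isBounded_Ω₂.closure.subset frontier_subset_closure

lemma memLp_vol {E : Type*} [NormedAddCommGroup E] [SecondCountableTopology E]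
    {f : Plane → E} (hf : Continuous f) : MemLp f 2 G.vol :=
  memLp_of_continuous hf G.isOpen_Ω₂.measurableSet G.isBounded_Ω₂ G.volume_Ω₂_lt_top

lemma memLp_bdry {f : Plane → ℝ} (hf : Continuous f) : MemLp f 2 G.bdry :=
  memLp_of_continuous hf isClosed_frontier.measurableSet G.isBounded_frontier G.arc_frontier_lt_top

/-- Triples consisting of a function, a vector field and a boundary function, all of class `L²`. -/
abbrev Triple : Type :=
  WithLp 2 (Lp ℝ 2 G.vol × WithLp 2 (Lp Plane 2 G.vol × Lp ℝ 2 G.bdry))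

/-- The function of a triple. -/
def valL : G.Triple →L[ℝ] Lp ℝ 2 G.vol := WithLp.fstL 2 ℝ _ _

/-- The vector field of a triple. -/
def gradL : G.Triple →L[ℝ] Lp Plane 2 G.vol := (WithLp.fstL 2 ℝ _ _).comp (WithLp.sndL 2 ℝ _ _)

/-- The boundary function of a triple. -/
def traceL : G.Triple →L[ℝ] Lp ℝ 2 G.bdry := (WithLp.sndL 2 ℝ _ _).comp (WithLp.sndL 2 ℝ _ _)

lemma norm_triple_sq (x : G.Triple) :
    ‖x‖ ^ 2 = ‖G.valL x‖ ^ 2 + ‖G.gradL x‖ ^ 2 + ‖G.traceL x‖ ^ 2 := by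
  rw [WithLp.prod_norm_sq_eq_of_L2, WithLp.prod_norm_sq_eq_of_L2, add_assoc]
  rfl

/-- The triple with the given components. -/
def triple (a : Lp ℝ 2 G.vol) (b : Lp Plane 2 G.vol) (c : Lp ℝ 2 G.bdry) : G.Triple :=
  WithLp.toLp 2 (a, WithLp.toLp 2 (b, c))

variable {G}

@[simp] lemma valL_triple (a b c) : G.valL (G.triple a b c) = a := rfl

@[simp] lemma gradL_triple (a b c) : G.gradL (G.triple a b c) = b := rfl

@[simp] lemma traceL_triple (a b c) : G.traceL (G.triple a b c) = c := rfl

lemma triple_ext {x y : G.Triple} (h1 : G.valL x = G.valL y) (h2 : G.gradL x = G.gradL y)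
    (h3 : G.traceL x = G.traceL y) : x = y := by
  have h : x - y = 0 := by
    have := G.norm_triple_sq (x - y)
    simp only [map_sub, h1, h2, h3, sub_self, norm_zero] at this
    simpa using this
  exact sub_eq_zero.1 h

lemma tendsto_triple {ι : Type*} {l : Filter ι} {x : ι → G.Triple} {y : G.Triple}
    (h1 : Tendsto (fun i => G.valL (x i)) l (𝓝 (G.valL y)))
    (h2 : Tendsto (fun i => G.gradL (x i)) l (𝓝 (G.gradL y)))
    (h3 : Tendsto (fun i => G.traceL (x i)) l (𝓝 (G.traceL y))) : Tendsto x l (𝓝 y) := by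
  have hx : ∀ x, G.triple (G.valL x) (G.gradL x) (G.traceL x) = x := fun x => triple_ext rfl rfl rfl
  have hc : Continuous fun q : Lp ℝ 2 G.vol × Lp Plane 2 G.vol × Lp ℝ 2 G.bdry =>
      G.triple q.1 q.2.1 q.2.2 := by
    refine (WithLp.prod_continuous_toLp 2 _ _).comp (continuous_fst.prodMk ?_)
    exact (WithLp.prod_continuous_toLp 2 _ _).comp continuous_snd
  have := (hc.tendsto (G.valL y, G.gradL y, G.traceL y)).comp
    (h1.prodMk_nhds (h2.prodMk_nhds h3))
  simpa [Function.comp_def, hx] using this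

variable (G)

/-- The triple of a function that is continuously differentiable up to the boundary. -/
def smoothTriple {φ : Plane → ℝ} (hφ : ContDiff ℝ 1 φ) : G.Triple :=
  G.triple ((G.memLp_vol hφ.continuous).toLp φ)
    ((G.memLp_vol (continuous_gradient hφ)).toLp (gradient φ))
    ((G.memLp_bdry hφ.continuous).toLp φ)

lemma gradient_add {φ ψ : Plane → ℝ} (hφ : ContDiff ℝ 1 φ) (hψ : ContDiff ℝ 1 ψ) :
    gradient (φ + ψ) = gradient φ + gradient ψ := by
  ext1 x
  simp only [gradient, Pi.add_apply]
  rw [fderiv_add (hφ.differentiable one_ne_zero x) (hψ.differentiable one_ne_zero x), map_add]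

lemma gradient_const_smul {φ : Plane → ℝ} (hφ : ContDiff ℝ 1 φ) (c : ℝ) :
    gradient (c • φ) = c • gradient φ := by
  ext1 x
  simp only [gradient, Pi.smul_apply]
  rw [fderiv_const_smul (hφ.differentiable one_ne_zero x), map_smul]

/-- The triples of smooth functions. -/
def smoothTriples : Submodule ℝ G.Triple where
  carrier := {x | ∃ (φ : Plane → ℝ) (hφ : ContDiff ℝ ∞ φ),
    x = G.smoothTriple (hφ.of_le (by exact_mod_cast le_top))}
  zero_mem' := by
    refine ⟨fun _ => 0, contDiff_const, ?_⟩
    have hg : gradient (fun _ : Plane => (0 : ℝ)) = 0 := by ext1 x; simp [gradient]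
    refine triple_ext ?_ ?_ ?_ <;> simp only [smoothTriple, valL_triple, gradL_triple,
      traceL_triple, map_zero, hg] <;> rfl
  add_mem' := by
    rintro _ _ ⟨φ, hφ, rfl⟩ ⟨ψ, hψ, rfl⟩
    refine ⟨φ + ψ, hφ.add hψ, ?_⟩
    have h1 : ContDiff ℝ 1 φ := hφ.of_le (by exact_mod_cast le_top)
    have h2 : ContDiff ℝ 1 ψ := hψ.of_le (by exact_mod_cast le_top)
    refine triple_ext ?_ ?_ ?_ <;> simp only [smoothTriple, valL_triple, gradL_triple,
      traceL_triple, map_add, gradient_add h1 h2] <;> rfl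
  smul_mem' := by
    rintro c _ ⟨φ, hφ, rfl⟩
    refine ⟨c • φ, hφ.const_smul c, ?_⟩
    have h1 : ContDiff ℝ 1 φ := hφ.of_le (by exact_mod_cast le_top)
    refine triple_ext ?_ ?_ ?_ <;> simp only [smoothTriple, valL_triple, gradL_triple,
      traceL_triple, map_smul, gradient_const_smul h1] <;> rfl

/-- The triples `(u, ∇u, trace of u)` with `u ∈ H¹(Ω₂)`. -/
def sobolev : Submodule ℝ G.Triple := G.smoothTriples.topologicalClosure

variable {G}

/-- The density principle that transfers every identity and inequality from `C¹` functions to `H¹`.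
-/
lemma sobolev_induction {P : G.Triple → Prop} (hP : IsClosed {x | P x})
    (h : ∀ (φ : Plane → ℝ) (hφ : ContDiff ℝ 1 φ), P (G.smoothTriple hφ)) {x : G.Triple}
    (hx : x ∈ G.sobolev) : P x := by
  have hsub : closure (G.smoothTriples : Set G.Triple) ⊆ {x | P x} := by
    refine closure_minimal ?_ hP
    rintro _ ⟨φ, hφ, rfl⟩
    exact h φ _
  exact hsub hx

end Geometry

/-- The triple of an element of `H¹(Ω₂)` and an `L²` function on the boundary. -/
def H1.toTriple {G : Geometry} (u : H1 G.Ω₂) {w : Plane → ℝ} (hw : MemLp w 2 G.bdry) : G.Triple :=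
  G.triple (u.memLp_val.toLp _) (u.memLp_grad.toLp _) (hw.toLp w)

namespace Geometry

variable {G : Geometry}

lemma toTriple_mem_sobolev {u : H1 G.Ω₂} {w : Plane → ℝ} (h : u.HasTrace w) :
    u.toTriple h.1 ∈ G.sobolev := by
  obtain ⟨hw, φ, hφ, h1, h2, h3⟩ := h
  have hφ1 : ∀ n, ContDiff ℝ 1 (φ n) := fun n => (hφ n).of_le (by exact_mod_cast le_top)
  refine mem_closure_iff_seq_limit.2 ⟨fun n => G.smoothTriple (hφ1 n), fun n => ⟨φ n, hφ n, rfl⟩,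
    tendsto_triple ?_ ?_ ?_⟩
  · exact (Lp.tendsto_Lp_iff_tendsto_eLpNorm'' _ (fun n => G.memLp_vol (hφ1 n).continuous) _
      u.memLp_val).2 h1
  · exact (Lp.tendsto_Lp_iff_tendsto_eLpNorm'' _
      (fun n => G.memLp_vol (continuous_gradient (hφ1 n))) _ u.memLp_grad).2 h2
  · exact (Lp.tendsto_Lp_iff_tendsto_eLpNorm'' _ (fun n => G.memLp_bdry (hφ1 n).continuous) _
      hw).2 h3

/-- Paired with a fixed vector, both sides are continuous in the triple, so the identity survives
the closure. -/
lemma weak_of_mem_sobolev {x : G.Triple} (hx : x ∈ G.sobolev) {φ : Plane → ℝ}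
    (hφ : ContDiff ℝ ∞ φ) (hc : HasCompactSupport φ) (hs : tsupport φ ⊆ G.Ω₂) :
    ∫ p in G.Ω₂, G.valL x p • gradient φ p = - ∫ p in G.Ω₂, φ p • G.gradL x p := by
  have hφ1 : ContDiff ℝ 1 φ := hφ.of_le (by exact_mod_cast le_top)
  have hg := continuous_gradient hφ1
  have m1 : MemLp (gradient φ) 2 G.vol := G.memLp_vol hg
  have m2 : MemLp φ 2 G.vol := G.memLp_vol hφ1.continuous
  have i1 : ∀ x : G.Triple, Integrable (fun p => G.valL x p • gradient φ p) G.vol := fun x =>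
    memLp_one_iff_integrable.1 (m1.smul (r := 1) (Lp.memLp (G.valL x)))
  have i2 : ∀ x : G.Triple, Integrable (fun p => φ p • G.gradL x p) G.vol := fun x =>
    memLp_one_iff_integrable.1 ((Lp.memLp (G.gradL x)).smul (r := 1) m2)
  refine ext_inner_left ℝ fun v => ?_
  have n1 : MemLp (fun p => inner ℝ v (gradient φ p)) 2 G.vol :=
    G.memLp_vol (continuous_const.inner hg)
  have n2 : MemLp (fun p => φ p • v) 2 G.vol := G.memLp_vol (hφ1.continuous.smul continuous_const)
  have e1 : ∀ x : G.Triple, inner ℝ v (∫ p in G.Ω₂, G.valL x p • gradient φ p) =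
      inner ℝ (n1.toLp _) (G.valL x) := by
    intro x
    rw [← integral_inner (i1 x), L2.inner_def]
    refine integral_congr_ae ?_
    filter_upwards [n1.coeFn_toLp] with p hp
    rw [hp, inner_smul_right]
    rfl
  have e2 : ∀ x : G.Triple, inner ℝ v (∫ p in G.Ω₂, φ p • G.gradL x p) =
      inner ℝ (n2.toLp _) (G.gradL x) := by
    intro x
    rw [← integral_inner (i2 x), L2.inner_def]
    refine integral_congr_ae ?_
    filter_upwards [n2.coeFn_toLp] with p hp
    rw [hp, inner_smul_right, inner_smul_left]
    rfl
  rw [inner_neg_right, e1, e2]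
  refine sobolev_induction (P := fun x => inner ℝ (n1.toLp _) (G.valL x) =
    -inner ℝ (n2.toLp _) (G.gradL x)) ?_ (fun ψ hψ => ?_) hx
  · exact isClosed_eq (continuous_const.inner G.valL.continuous)
      (continuous_const.inner G.gradL.continuous).neg
  · rw [← e1, ← e2, ← inner_neg_right]
    congr 1
    have h := setIntegral_smul_gradient hψ hφ1 hc hs
    refine Eq.trans ?_ (h.trans ?_)
    · refine integral_congr_ae ?_
      filter_upwards [(G.memLp_vol hψ.continuous).coeFn_toLp] with p hp
      simp only [smoothTriple, valL_triple, hp]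
    · rw [neg_inj]
      refine integral_congr_ae ?_
      filter_upwards [(G.memLp_vol (continuous_gradient hψ)).coeFn_toLp] with p hp
      simp only [smoothTriple, gradL_triple, hp]

/-- With `toTriple_mem_sobolev`, this identifies `sobolev` with the pairs of an `H¹` function and
its trace, so quantifiers over such pairs become quantifiers over a closed subspace. -/
lemma exists_toTriple_eq {x : G.Triple} (hx : x ∈ G.sobolev) :
    ∃ (u : H1 G.Ω₂) (w : Plane → ℝ) (h : u.HasTrace w), u.toTriple h.1 = x := by
  refine ⟨⟨G.valL x, G.gradL x, Lp.memLp _, Lp.memLp _,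
    fun φ hφ hc hs => weak_of_mem_sobolev hx hφ hc hs⟩, G.traceL x, ⟨Lp.memLp _, ?_⟩, ?_⟩
  · obtain ⟨y, hy, hlim⟩ := mem_closure_iff_seq_limit.1 hx
    choose φ hφ hyφ using hy
    refine ⟨φ, hφ, ?_, ?_, ?_⟩
    · have h := (G.valL.continuous.tendsto x).comp hlim
      rw [Lp.tendsto_Lp_iff_tendsto_eLpNorm'] at h
      refine h.congr fun n => eLpNorm_congr_ae ?_
      filter_upwards [(G.memLp_vol (hφ n).continuous).coeFn_toLp] with p hp
      simp only [Function.comp_apply, hyφ, smoothTriple, valL_triple, Pi.sub_apply, hp]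
    · have h := (G.gradL.continuous.tendsto x).comp hlim
      rw [Lp.tendsto_Lp_iff_tendsto_eLpNorm'] at h
      refine h.congr fun n => eLpNorm_congr_ae ?_
      filter_upwards [(G.memLp_vol (continuous_gradient
        ((hφ n).of_le (by exact_mod_cast le_top)))).coeFn_toLp] with p hp
      simp only [Function.comp_apply, hyφ, smoothTriple, gradL_triple, Pi.sub_apply, hp]
    · have h := (G.traceL.continuous.tendsto x).comp hlim
      rw [Lp.tendsto_Lp_iff_tendsto_eLpNorm'] at h
      refine h.congr fun n => eLpNorm_congr_ae ?_
      filter_upwards [(G.memLp_bdry (hφ n).continuous).coeFn_toLp] with p hp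
      simp only [Function.comp_apply, hyφ, smoothTriple, traceL_triple, Pi.sub_apply, hp]
  · refine triple_ext ?_ ?_ ?_ <;> simp [H1.toTriple]

end Geometry

/-! ### Lax–Milgram and coercivity. -/

lemma norm_sq_le_of_enorm_sq_le {E₁ E₂ E₃ : Type*} [NormedAddCommGroup E₁] [NormedAddCommGroup E₂]
    [NormedAddCommGroup E₃] {a : E₁} {b : E₂} {d : E₃} {c : ℝ≥0}
    (h : ‖a‖ₑ ^ 2 ≤ c * (‖b‖ₑ ^ 2 + ‖d‖ₑ ^ 2)) : ‖a‖ ^ 2 ≤ c * (‖b‖ ^ 2 + ‖d‖ ^ 2) := by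
  simp only [enorm_eq_nnnorm] at h
  have hnn : ‖a‖₊ ^ 2 ≤ c * (‖b‖₊ ^ 2 + ‖d‖₊ ^ 2) := by exact_mod_cast h
  exact_mod_cast hnn

/-- The Lax–Milgram theorem on a closed subspace. -/
lemma exists_mem_forall_bilin_eq {E : Type*} [NormedAddCommGroup E] [InnerProductSpace ℝ E]
    [CompleteSpace E] {K : Submodule ℝ E} (hK : IsClosed (K : Set E)) (B : E →L[ℝ] E →L[ℝ] ℝ)
    {c : ℝ} (hc : 0 < c) (hB : ∀ x ∈ K, c * ‖x‖ ^ 2 ≤ B x x) (f : E →L[ℝ] ℝ) :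
    ∃ x ∈ K, ∀ y ∈ K, B x y = f y := by
  have : CompleteSpace K := hK.completeSpace_coe
  set B' : K →L[ℝ] K →L[ℝ] ℝ := B.bilinearComp K.subtypeL K.subtypeL
  have hB' : IsCoercive B' := by
    refine ⟨c, hc, fun x => ?_⟩
    have := hB x x.2
    rw [pow_two, ← mul_assoc] at this
    exact this
  set z : K := (InnerProductSpace.toDual ℝ K).symm (f.comp K.subtypeL)
  refine ⟨(hB'.continuousLinearEquivOfBilin.symm z : K), Subtype.property _, fun y hy => ?_⟩
  have h1 := hB'.continuousLinearEquivOfBilin_apply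
    (hB'.continuousLinearEquivOfBilin.symm z) ⟨y, hy⟩
  rw [ContinuousLinearEquiv.apply_symm_apply, InnerProductSpace.toDual_symm_apply] at h1
  exact h1.symm

namespace Geometry

variable (G : Geometry)

lemma bdry_restrict {s : Set Plane} (hs : MeasurableSet s) :
    G.bdry.restrict s = arc.restrict (s ∩ frontier G.Ω₂) := Measure.restrict_restrict hs

lemma bdry_restrict_Γ : G.bdry.restrict G.Γ = arc.restrict G.Γ := by
  rw [G.bdry_restrict G.measurableSet_Γ, inter_eq_left.2 G.Γ_subset_frontier]

/-- The boundary function of a triple, restricted to a part of the boundary. -/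
def resL (s : Set Plane) : G.Triple →L[ℝ] Lp ℝ 2 (G.bdry.restrict s) :=
  (LpToLpRestrictCLM Plane ℝ ℝ G.bdry 2 s).comp G.traceL

lemma coeFn_resL (s : Set Plane) (x : G.Triple) : G.resL s x =ᵐ[G.bdry.restrict s] G.traceL x :=
  LpToLpRestrictCLM_coeFn ℝ s (G.traceL x)

variable {G}

lemma coeFn_resL_toTriple {u : H1 G.Ω₂} {w : Plane → ℝ} (hw : MemLp w 2 G.bdry) (s : Set Plane) :
    G.resL s (u.toTriple hw) =ᵐ[G.bdry.restrict s] w := by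
  refine (G.coeFn_resL s _).trans (ae_restrict_of_ae ?_)
  exact hw.coeFn_toLp

variable (G)

lemma exists_norm_traceL_sq_le : ∃ c : ℝ≥0, ∀ x ∈ G.sobolev,
    ‖G.traceL x‖ ^ 2 ≤ c * (‖G.valL x‖ ^ 2 + ‖G.gradL x‖ ^ 2) := by
  obtain ⟨c, hc⟩ := exists_trace_bound G.isOpen_Ω₂ G.isBounded_Ω₂ G.lipschitz
  refine ⟨c, fun x hx => sobolev_induction (P := fun x =>
    ‖G.traceL x‖ ^ 2 ≤ c * (‖G.valL x‖ ^ 2 + ‖G.gradL x‖ ^ 2)) ?_ (fun φ hφ => ?_) hx⟩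
  · exact isClosed_le (by fun_prop) (by fun_prop)
  · refine norm_sq_le_of_enorm_sq_le ?_
    simp only [smoothTriple, valL_triple, gradL_triple, traceL_triple, Lp.enorm_toLp,
      eLpNorm_two_sq]
    exact hc φ hφ

/-- This is the source of coercivity: the interface term of the Robin condition controls the
constants, so no Dirichlet condition on `ΓR` is needed, which may have zero length. -/
lemma exists_norm_sq_le : ∃ c : ℝ≥0, ∀ x ∈ G.sobolev,
    ‖x‖ ^ 2 ≤ c * (‖G.gradL x‖ ^ 2 + ‖G.resL G.Γ x‖ ^ 2) := by
  obtain ⟨a, ha⟩ := G.exists_norm_traceL_sq_le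
  obtain ⟨c, hc⟩ := G.controlled_Ω₂
  have hval : ∀ x ∈ G.sobolev, ‖G.valL x‖ ^ 2 ≤ c * (‖G.gradL x‖ ^ 2 + ‖G.resL G.Γ x‖ ^ 2) := by
    intro x hx
    refine sobolev_induction (P := fun x =>
      ‖G.valL x‖ ^ 2 ≤ c * (‖G.gradL x‖ ^ 2 + ‖G.resL G.Γ x‖ ^ 2)) ?_ (fun φ hφ => ?_) hx
    · exact isClosed_le (by fun_prop) (by fun_prop)
    · refine norm_sq_le_of_enorm_sq_le ?_
      have hΓ : ‖G.resL G.Γ (G.smoothTriple hφ)‖ₑ ^ 2 = ∫⁻ p in G.Γ, ‖φ p‖ₑ ^ 2 ∂arc := by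
        rw [Lp.enorm_sq_eq, ← bdry_restrict_Γ]
        refine lintegral_congr_ae ?_
        filter_upwards [G.coeFn_resL G.Γ (G.smoothTriple hφ),
          ae_restrict_of_ae (G.memLp_bdry hφ.continuous).coeFn_toLp] with p h1 h2
        rw [h1]
        simp only [smoothTriple, traceL_triple, h2]
      rw [hΓ]
      simp only [smoothTriple, valL_triple, gradL_triple, Lp.enorm_toLp, eLpNorm_two_sq]
      exact hc φ hφ
  -- The summands account for the function, the gradient and, through the trace inequality, the
  -- boundary values.
  refine ⟨c + 1 + a * (c + 1), fun x hx => ?_⟩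
  have h1 := hval x hx
  have h2 := ha x hx
  rw [norm_triple_sq]
  push_cast
  have ha0 : (0 : ℝ) ≤ a := a.2
  have hr := sq_nonneg ‖G.resL G.Γ x‖
  have h3 : (a : ℝ) * (‖G.valL x‖ ^ 2 + ‖G.gradL x‖ ^ 2) ≤
      a * ((c + 1) * (‖G.gradL x‖ ^ 2 + ‖G.resL G.Γ x‖ ^ 2)) := by
    gcongr
    nlinarith
  nlinarith

/-- The bilinear form of the two-dimensional problem. -/
def form (κ lam : ℝ) : G.Triple →L[ℝ] G.Triple →L[ℝ] ℝ :=
  (innerSL ℝ).bilinearComp G.gradL G.gradL +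
    (κ • (innerSL ℝ).bilinearComp (G.resL G.ΓB) (G.resL G.ΓB) +
      lam • (innerSL ℝ).bilinearComp (G.resL G.Γ) (G.resL G.Γ))

lemma form_apply (κ lam : ℝ) (x y : G.Triple) :
    G.form κ lam x y = inner ℝ (G.gradL x) (G.gradL y) +
      (κ * inner ℝ (G.resL G.ΓB x) (G.resL G.ΓB y) +
        lam * inner ℝ (G.resL G.Γ x) (G.resL G.Γ y)) := rfl

/-- The triples of functions in `H¹(Ω₂)` that vanish on `ΓR`. -/
def homogeneous : Submodule ℝ G.Triple := G.sobolev ⊓ (G.resL G.ΓR).ker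

lemma isClosed_homogeneous : IsClosed (G.homogeneous : Set G.Triple) :=
  G.smoothTriples.isClosed_topologicalClosure.inter (G.resL G.ΓR).isClosed_ker

variable {G} {κ lam : ℝ}

lemma exists_coercive (hκ : 0 ≤ κ) (hlam : 0 < lam) :
    ∃ c : ℝ, 0 < c ∧ ∀ x ∈ G.sobolev, c * ‖x‖ ^ 2 ≤ G.form κ lam x x := by
  obtain ⟨c, hc⟩ := G.exists_norm_sq_le
  have hm : 0 < min 1 lam := lt_min one_pos hlam
  refine ⟨min 1 lam / (c + 1), by positivity, fun x hx => ?_⟩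
  have h := hc x hx
  rw [form_apply, real_inner_self_eq_norm_sq, real_inner_self_eq_norm_sq,
    real_inner_self_eq_norm_sq, div_mul_eq_mul_div, div_le_iff₀ (by positivity)]
  have hB := mul_nonneg hκ (sq_nonneg ‖G.resL G.ΓB x‖)
  have h1 : min 1 lam * ‖G.gradL x‖ ^ 2 ≤ 1 * ‖G.gradL x‖ ^ 2 := by
    gcongr; exact min_le_left _ _
  have h2 : min 1 lam * ‖G.resL G.Γ x‖ ^ 2 ≤ lam * ‖G.resL G.Γ x‖ ^ 2 := by
    gcongr; exact min_le_right _ _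
  have hc0 : (0 : ℝ) ≤ c := c.2
  have hg := sq_nonneg ‖G.gradL x‖
  have hr := sq_nonneg ‖G.resL G.Γ x‖
  set S := ‖G.gradL x‖ ^ 2 + ‖G.resL G.Γ x‖ ^ 2
  have h3 : min 1 lam * ‖x‖ ^ 2 ≤ (min 1 lam * S) * (c + 1) := by
    have : ‖x‖ ^ 2 ≤ S * (c + 1) := by nlinarith
    calc min 1 lam * ‖x‖ ^ 2 ≤ min 1 lam * (S * (c + 1)) := by gcongr
      _ = _ := by ring
  refine h3.trans ?_
  gcongr
  simp only [S]
  linarith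

/-- Existence of weak solutions by the Lax–Milgram theorem. -/
lemma exists_form_eq (hκ : 0 ≤ κ) (hlam : 0 < lam) (f : G.Triple →L[ℝ] ℝ) :
    ∃ x ∈ G.homogeneous, ∀ y ∈ G.homogeneous, G.form κ lam x y = f y := by
  obtain ⟨c, hc, h⟩ := exists_coercive (G := G) hκ hlam
  exact exists_mem_forall_bilin_eq G.isClosed_homogeneous (G.form κ lam) hc
    (fun x hx => h x hx.1) f

lemma eq_zero_of_form_eq_zero (hκ : 0 ≤ κ) (hlam : 0 < lam) {x : G.Triple} (hx : x ∈ G.sobolev)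
    (h : G.form κ lam x x = 0) : x = 0 := by
  obtain ⟨c, hc, hco⟩ := exists_coercive (G := G) hκ hlam
  have := hco x hx
  rw [h] at this
  have h2 : ‖x‖ ^ 2 = 0 := le_antisymm (by nlinarith [sq_nonneg ‖x‖]) (sq_nonneg _)
  simpa using h2

end Geometry

/-- The trace is determined by the function. -/
lemma H1.HasTrace.ae_eq {G : Geometry} {u : H1 G.Ω₂} {w w' : Plane → ℝ} (h : u.HasTrace w)
    (h' : u.HasTrace w') : w =ᵐ[G.bdry] w' := by
  obtain ⟨c, hc⟩ := G.exists_norm_traceL_sq_le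
  -- The difference of the two triples has zero function and zero gradient, so the trace inequality
  -- annihilates its boundary component.
  have := hc _ (G.sobolev.sub_mem (Geometry.toTriple_mem_sobolev h)
    (Geometry.toTriple_mem_sobolev h'))
  simp only [map_sub, H1.toTriple, Geometry.valL_triple, Geometry.gradL_triple,
    Geometry.traceL_triple, sub_self, norm_zero] at this
  have h0 : h.1.toLp w - h'.1.toLp w' = 0 := by
    rw [← norm_eq_zero]
    nlinarith [norm_nonneg (h.1.toLp w - h'.1.toLp w')]
  exact (MemLp.toLp_eq_toLp_iff _ _).1 (sub_eq_zero.1 h0)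

/-! ### The Robin problem on `Ω₂` and its affine dependence on the datum. -/

namespace Geometry

variable (G : Geometry)

/-- The functional `v ↦ ∫ F v`. -/
def sourceL {F : Plane → ℝ} (hF : MemLp F 2 G.vol) : G.Triple →L[ℝ] ℝ :=
  (innerSL ℝ (hF.toLp F)).comp G.valL

/-- The constant function `1` on the interface. -/
def interfaceOne : Lp ℝ 2 (G.bdry.restrict G.Γ) := (memLp_const (1 : ℝ)).toLp _

/-- The integral of the trace over the interface. -/
def interfaceL : G.Triple →L[ℝ] ℝ := (innerSL ℝ G.interfaceOne).comp (G.resL G.Γ)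

lemma norm_interfaceOne_sq : ‖G.interfaceOne‖ ^ 2 = G.H := by
  rw [← real_inner_self_eq_norm_sq, interfaceOne, inner_toLp, bdry_restrict_Γ]
  simp [Measure.real, arc_Γ, G.H_pos.le]

variable {G}

lemma inner_resL_toTriple {u v : H1 G.Ω₂} {w y : Plane → ℝ} (hw : MemLp w 2 G.bdry)
    (hy : MemLp y 2 G.bdry) (s : Set Plane) :
    inner ℝ (G.resL s (u.toTriple hw)) (G.resL s (v.toTriple hy)) =
      ∫ p, w p * y p ∂(G.bdry.restrict s) := by
  rw [L2.inner_def]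
  refine integral_congr_ae ?_
  filter_upwards [coeFn_resL_toTriple (u := u) hw s, coeFn_resL_toTriple (u := v) hy s] with p h1 h2
  rw [h1, h2]
  simp [mul_comm]

lemma form_toTriple {κ lam : ℝ} {u v : H1 G.Ω₂} {w y : Plane → ℝ} (hw : MemLp w 2 G.bdry)
    (hy : MemLp y 2 G.bdry) :
    G.form κ lam (u.toTriple hw) (v.toTriple hy) =
      (∫ p in G.Ω₂, inner ℝ (u.grad p) (v.grad p))
        + κ * (∫ p in G.ΓB ∩ frontier G.Ω₂, w p * y p ∂arc)
        + lam * (∫ p in G.Γ, w p * y p ∂arc) := by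
  rw [form_apply, inner_resL_toTriple, inner_resL_toTriple, bdry_restrict_Γ,
    G.bdry_restrict G.measurable_ΓB, ← add_assoc]
  simp only [H1.toTriple, gradL_triple, inner_toLp]

lemma sourceL_toTriple {F : Plane → ℝ} (hF : MemLp F 2 G.vol) {v : H1 G.Ω₂} {y : Plane → ℝ}
    (hy : MemLp y 2 G.bdry) :
    G.sourceL hF (v.toTriple hy) = ∫ p in G.Ω₂, F p * v.val p := by
  change inner ℝ (hF.toLp F) (v.memLp_val.toLp _) = _
  rw [inner_toLp]
  simp [mul_comm]

lemma interfaceL_toTriple {v : H1 G.Ω₂} {y : Plane → ℝ} (hy : MemLp y 2 G.bdry) :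
    G.interfaceL (v.toTriple hy) = ∫ p in G.Γ, y p ∂arc := by
  change inner ℝ G.interfaceOne (G.resL G.Γ (v.toTriple hy)) = _
  rw [← bdry_restrict_Γ, L2.inner_def]
  refine integral_congr_ae ?_
  filter_upwards [coeFn_resL_toTriple (u := v) hy G.Γ,
    (memLp_const (μ := G.bdry.restrict G.Γ) (p := 2) (1 : ℝ)).coeFn_toLp] with p h1 h2
  rw [h1, interfaceOne, h2]
  simp

lemma avg_eq_interfaceL {v : H1 G.Ω₂} {y : Plane → ℝ} (hy : MemLp y 2 G.bdry) :
    G.avg y G.L₀ = G.interfaceL (v.toTriple hy) / G.H := by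
  rw [interfaceL_toTriple, avg_eq_integral_Γ]
  ring

lemma resL_eq_iff {u v : H1 G.Ω₂} {w y : Plane → ℝ} (hw : MemLp w 2 G.bdry)
    (hy : MemLp y 2 G.bdry) :
    G.resL G.ΓR (u.toTriple hw) = G.resL G.ΓR (v.toTriple hy) ↔
      w =ᵐ[arc.restrict (G.ΓR ∩ frontier G.Ω₂)] y := by
  rw [Lp.ext_iff, ← G.bdry_restrict G.measurable_ΓR]
  have h1 := coeFn_resL_toTriple (u := u) hw G.ΓR
  have h2 := coeFn_resL_toTriple (u := v) hy G.ΓR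
  exact ⟨fun h => h1.symm.trans (h.trans h2), fun h => h1.trans (h.trans h2.symm)⟩

lemma toTriple_mem_homogeneous {v : H1 G.Ω₂} {y : Plane → ℝ} (h : v.HasTrace y) :
    v.toTriple h.1 ∈ G.homogeneous ↔
      ∀ᵐ p ∂(arc.restrict (G.ΓR ∩ frontier G.Ω₂)), y p = 0 := by
  have hker : v.toTriple h.1 ∈ G.homogeneous ↔ G.resL G.ΓR (v.toTriple h.1) = 0 :=
    ⟨fun h' => h'.2, fun h' => ⟨toTriple_mem_sobolev h, h'⟩⟩
  rw [hker, Lp.eq_zero_iff_ae_eq_zero, ← G.bdry_restrict G.measurable_ΓR]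
  have h1 := coeFn_resL_toTriple (u := v) h.1 G.ΓR
  exact ⟨fun h => h1.symm.trans h, fun h => h1.trans h⟩

/-- The weak formulation, in terms of triples. -/
lemma weak_iff {κ lam : ℝ} {F : Plane → ℝ} (hF : MemLp F 2 G.vol) {c : ℝ} {u : H1 G.Ω₂}
    {w : Plane → ℝ} (hw : MemLp w 2 G.bdry) :
    (∀ (v : H1 G.Ω₂) (y : Plane → ℝ), v.HasTrace y →
      (∀ᵐ p ∂(arc.restrict (G.ΓR ∩ frontier G.Ω₂)), y p = 0) →
      (∫ p in G.Ω₂, inner ℝ (u.grad p) (v.grad p))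
          + κ * (∫ p in G.ΓB ∩ frontier G.Ω₂, w p * y p ∂arc)
          + lam * (∫ p in G.Γ, w p * y p ∂arc)
        = (∫ p in G.Ω₂, F p * v.val p) + ∫ p in G.Γ, c * y p ∂arc) ↔
    ∀ z ∈ G.homogeneous, G.form κ lam (u.toTriple hw) z = G.sourceL hF z + c * G.interfaceL z := by
  constructor
  · intro h z hz
    obtain ⟨v, y, hy, rfl⟩ := exists_toTriple_eq hz.1
    have := h v y hy ((toTriple_mem_homogeneous hy).1 hz)
    rw [form_toTriple, this, sourceL_toTriple, interfaceL_toTriple, integral_const_mul]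
  · intro h v y hy h0
    have := h _ ((toTriple_mem_homogeneous hy).2 h0)
    rw [form_toTriple, sourceL_toTriple, interfaceL_toTriple] at this
    rw [this, integral_const_mul]

lemma form_sub_left (κ lam : ℝ) (x y z : G.Triple) :
    G.form κ lam (x - y) z = G.form κ lam x z - G.form κ lam y z := by
  rw [map_sub]
  rfl

/-- The solution of the two-dimensional problem depends affinely on the Robin datum. -/
lemma exists_affine_solution2D {κ lam : ℝ} (hκ : 0 ≤ κ) (hlam : 0 < lam)
    {F γ₂ : Plane → ℝ} (hF : MemLp F 2 G.vol) (hγ₂ : IsDirichletDatum G γ₂) :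
    ∃ x₀ x₁ : G.Triple, x₀ ∈ G.sobolev ∧ x₁ ∈ G.sobolev ∧
      0 ≤ G.interfaceL x₁ ∧ lam * G.interfaceL x₁ ≤ G.H ∧
      (∀ c u, IsSolution2D G κ lam F γ₂ c u →
        ∃ (w : Plane → ℝ) (h : u.HasTrace w), u.toTriple h.1 = x₀ + c • x₁) ∧
      ∀ c (u : H1 G.Ω₂) (w : Plane → ℝ) (h : u.HasTrace w), u.toTriple h.1 = x₀ + c • x₁ →
        IsSolution2D G κ lam F γ₂ c u := by
  obtain ⟨uD, wD, hD, hDγ⟩ := hγ₂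
  -- `xD` lifts the Dirichlet datum, `y` corrects it to a solution with Robin datum zero, and `x₁`
  -- is the response to the unit Robin datum alone.
  set xD := uD.toTriple hD.1
  have hxD : xD ∈ G.sobolev := toTriple_mem_sobolev hD
  obtain ⟨y, hy, hyf⟩ := exists_form_eq (G := G) hκ hlam (G.sourceL hF - G.form κ lam xD)
  obtain ⟨x₁, hx₁, hx₁f⟩ := exists_form_eq (G := G) hκ hlam G.interfaceL
  have hres : ∀ c : ℝ, G.resL G.ΓR (xD + y + c • x₁) = G.resL G.ΓR xD := fun c => by
    have h1 : G.resL G.ΓR y = 0 := hy.2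
    have h2 : G.resL G.ΓR x₁ = 0 := hx₁.2
    rw [map_add, map_add, map_smul, h1, h2]
    simp
  have hform : ∀ c : ℝ, ∀ z ∈ G.homogeneous,
      G.form κ lam (xD + y + c • x₁) z = G.sourceL hF z + c * G.interfaceL z := fun c z hz => by
    have h1 := hyf z hz
    have h2 := hx₁f z hz
    simp only [map_add, map_smul, add_apply, smul_apply,
      h1, h2, sub_apply, smul_eq_mul]
    ring
  -- Energy identity of `x₁`: its integral over `Γ` is a sum of nonnegative terms, one of which is
  -- `lam` times its squared norm on `Γ`.
  have hself := hx₁f x₁ hx₁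
  rw [form_apply, real_inner_self_eq_norm_sq, real_inner_self_eq_norm_sq,
    real_inner_self_eq_norm_sq] at hself
  have hB := mul_nonneg hκ (sq_nonneg ‖G.resL G.ΓB x₁‖)
  have hG := mul_nonneg hlam.le (sq_nonneg ‖G.resL G.Γ x₁‖)
  have hgrad := sq_nonneg ‖G.gradL x₁‖
  have hnn : 0 ≤ G.interfaceL x₁ := by linarith
  refine ⟨xD + y, x₁, G.sobolev.add_mem hxD hy.1, hx₁.1, hnn, ?_, ?_, ?_⟩
  -- With `I` the integral of `x₁` over `Γ`, Cauchy–Schwarz gives `lam I² ≤ H lam ‖x₁‖² ≤ H I`;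
  -- dividing by `I` requires the case `I = 0` apart.
  · have hcs : G.interfaceL x₁ ≤ ‖G.interfaceOne‖ * ‖G.resL G.Γ x₁‖ :=
      real_inner_le_norm G.interfaceOne (G.resL G.Γ x₁)
    have hH := G.norm_interfaceOne_sq
    have hHpos := G.H_pos
    have hsq : G.interfaceL x₁ ^ 2 ≤ G.H * ‖G.resL G.Γ x₁‖ ^ 2 := by
      rw [← hH, ← mul_pow]; gcongr
    have h3 : lam * ‖G.resL G.Γ x₁‖ ^ 2 ≤ G.interfaceL x₁ := by linarith
    rcases hnn.eq_or_lt with h0 | hpos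
    · rw [← h0, mul_zero]; exact hHpos.le
    · refine le_of_mul_le_mul_right ?_ hpos
      nlinarith
  · rintro c u ⟨w, hw, hwγ, hweak⟩
    refine ⟨w, hw, ?_⟩
    have hf := (weak_iff hF hw.1).1 hweak
    -- Uniqueness: the difference vanishes on `ΓR`, hence is an admissible test function for itself.
    set d := u.toTriple hw.1 - (xD + y + c • x₁) with hd
    have hdmem : d ∈ G.homogeneous := by
      refine ⟨G.sobolev.sub_mem (toTriple_mem_sobolev hw)
        (G.sobolev.add_mem (G.sobolev.add_mem hxD hy.1) (G.sobolev.smul_mem c hx₁.1)), ?_⟩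
      change G.resL G.ΓR d = 0
      rw [hd, map_sub, hres, sub_eq_zero, resL_eq_iff]
      filter_upwards [hwγ, hDγ] with p h1 h2
      rw [h1, h2]
    have hzero : G.form κ lam d d = 0 := by
      have e : G.form κ lam d d = G.form κ lam (u.toTriple hw.1) d -
          G.form κ lam (xD + y + c • x₁) d := form_sub_left κ lam _ _ d
      rw [e, hf d hdmem, hform c d hdmem, sub_self]
    exact sub_eq_zero.1 (eq_zero_of_form_eq_zero hκ hlam hdmem.1 hzero)
  · intro c u w hw hx
    refine ⟨w, hw, ?_, (weak_iff hF hw.1).2 ?_⟩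
    · have := hres c
      rw [← hx, resL_eq_iff] at this
      filter_upwards [this, hDγ] with p h1 h2
      rw [h1, h2]
    · rw [hx]
      exact hform c

end Geometry

/-! ### The normal derivative on the interface. -/

namespace Geometry

variable {G : Geometry}

lemma memLp_Γ {w : Plane → ℝ} (hw : MemLp w 2 G.bdry) : MemLp w 2 (arc.restrict G.Γ) :=
  hw.mono_measure (Measure.restrict_mono G.Γ_subset_frontier le_rfl)

instance : IsFiniteMeasure (arc.restrict G.Γ) := ⟨by simp [arc_Γ]⟩

/-- The interface lies inside the open set `Ω`, away from its boundary. -/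
lemma disjoint_Γ_of_subset_frontier {s : Set Plane} (hs : s ⊆ frontier G.Ω) : Disjoint s G.Γ := by
  refine Set.disjoint_left.2 fun p hp hΓ => ?_
  have := hs hp
  rw [G.isOpen.frontier_eq] at this
  exact this.2 (G.Γ_subset_Ω hΓ)

lemma inter_frontier_subset {s : Set Plane} (hs : s ⊆ frontier G.Ω) :
    s ∩ frontier G.Ω₂ ⊆ frontier G.Ω₂ \ G.Γ := fun _ hp =>
  ⟨hp.2, Set.disjoint_left.1 (disjoint_Γ_of_subset_frontier hs) hp.1⟩

lemma mem_Γ_of_mem_frontier {p : Plane} (hp : p ∈ frontier G.Ω₂) (h0 : p 0 < G.L₂)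
    (h1 : p 1 ∈ Ioo 0 G.H) : p ∈ G.Γ := by
  rw [G.isOpen_Ω₂.frontier_eq] at hp
  refine ⟨le_antisymm ?_ ?_, h1⟩
  · by_contra h
    exact hp.2 ((G.mem_Ω₂_iff h0).2 ⟨not_le.1 h, h1⟩)
  · have hcl : IsClosed {p : Plane | G.L₀ ≤ p 0} := isClosed_le continuous_const (by fun_prop)
    exact closure_minimal (fun q hq => le_of_lt (show G.L₀ < q 0 from hq.2)) hcl hp.1

/-- A weak solution has the normal derivative prescribed by the Robin condition. -/
lemma hasNormalDeriv_of_isSolution2D {κ lam c : ℝ} {F γ₂ w : Plane → ℝ} (hF : MemLp F 2 G.vol)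
    {u : H1 G.Ω₂} (hu : IsSolution2D G κ lam F γ₂ c u) (hw : u.HasTrace w) :
    u.HasNormalDeriv G.Γ fun p => c - lam * w p := by
  obtain ⟨w', hw', -, hweak⟩ := hu
  have hww : w =ᵐ[G.bdry] w' := hw.ae_eq hw'
  refine ⟨(memLp_const c).sub ((memLp_Γ hw.1).const_mul lam), fun p => -F p, hF.neg,
    fun v y hy h0 => ?_⟩
  -- A test function vanishing off `Γ` vanishes on `ΓR` and `ΓB`, so it is admissible and only the
  -- interface terms of the weak form remain.
  have hzero : ∀ {s : Set Plane}, s ⊆ frontier G.Ω →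
      ∀ᵐ p ∂(arc.restrict (s ∩ frontier G.Ω₂)), y p = 0 := fun hs =>
    ae_restrict_of_ae_restrict_of_subset (inter_frontier_subset hs) h0
  have h := hweak v y hy (hzero G.ΓR_subset)
  have hB : ∫ p in G.ΓB ∩ frontier G.Ω₂, w' p * y p ∂arc = 0 := by
    refine integral_eq_zero_of_ae ?_
    filter_upwards [hzero G.ΓB_subset] with p hp
    simp [hp]
  have hΓ : ∫ p in G.Γ, w' p * y p ∂arc = ∫ p in G.Γ, w p * y p ∂arc := by
    refine integral_congr_ae ?_
    filter_upwards [ae_restrict_of_ae_restrict_of_subset G.Γ_subset_frontier hww] with p hp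
    rw [hp]
  have hyΓ := memLp_Γ hy.1
  have i1 : Integrable (fun p => c * y p) (arc.restrict G.Γ) :=
    (hyΓ.integrable (by norm_num)).const_mul c
  have i2 : Integrable (fun p => lam * (w p * y p)) (arc.restrict G.Γ) :=
    ((memLp_Γ hw.1).integrable_mul hyΓ).const_mul lam
  have e : ∫ p in G.Γ, (c - lam * w p) * y p ∂arc =
      (∫ p in G.Γ, c * y p ∂arc) - lam * ∫ p in G.Γ, w p * y p ∂arc := by
    rw [← integral_const_mul lam, ← integral_sub i1 i2]
    exact integral_congr_ae (ae_of_all _ fun p => by ring)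
  have en : ∫ p in G.Ω₂, -F p * v.val p = -∫ p in G.Ω₂, F p * v.val p := by
    rw [← integral_neg]
    exact integral_congr_ae (ae_of_all _ fun p => by ring)
  rw [hB, hΓ] at h
  rw [e, en]
  linear_combination h

variable (G) in
/-- A smooth function as an element of `H¹(Ω₂)`. -/
def smoothH1 {φ : Plane → ℝ} (hφ : ContDiff ℝ 1 φ) : H1 G.Ω₂ where
  val := φ
  grad := gradient φ
  memLp_val := G.memLp_vol hφ.continuous
  memLp_grad := G.memLp_vol (continuous_gradient hφ)
  weak ψ hψ hc hs := setIntegral_smul_gradient hφ (hψ.of_le (by exact_mod_cast le_top)) hc hs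

lemma smoothH1_hasTrace {φ : Plane → ℝ} (hφ : ContDiff ℝ ∞ φ) (hφ1 : ContDiff ℝ 1 φ) :
    (G.smoothH1 hφ1).HasTrace φ :=
  ⟨G.memLp_bdry hφ.continuous, fun _ => φ, fun _ => hφ, by simp [smoothH1], by simp [smoothH1],
    by simp⟩

/-- The normal derivative on `Γ` is unique. -/
lemma normalDeriv_ae_eq {u : H1 G.Ω₂} {q q' : Plane → ℝ} (h : u.HasNormalDeriv G.Γ q)
    (h' : u.HasNormalDeriv G.Γ q') : q =ᵐ[arc.restrict G.Γ] q' := by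
  obtain ⟨hq, l, hl, hgreen⟩ := h
  obtain ⟨hq', l', hl', hgreen'⟩ := h'
  -- Subtracting the two Green formulas cancels the gradient term.
  have hdiff : ∀ φ : Plane → ℝ, ContDiff ℝ ∞ φ → (∀ p ∈ frontier G.Ω₂ \ G.Γ, φ p = 0) →
      ∫ p in G.Ω₂, φ p * (l p - l' p) = ∫ p in G.Γ, φ p * (q p - q' p) ∂arc := by
    intro φ hφ h0
    have hφ1 : ContDiff ℝ 1 φ := hφ.of_le (by exact_mod_cast le_top)
    have hz : ∀ᵐ p ∂(arc.restrict (frontier G.Ω₂ \ G.Γ)), φ p = 0 := by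
      filter_upwards [ae_restrict_mem
        (isClosed_frontier.measurableSet.diff G.measurableSet_Γ)] with p hp using h0 p hp
    have e := hgreen _ φ (smoothH1_hasTrace hφ hφ1) hz
    have e' := hgreen' _ φ (smoothH1_hasTrace hφ hφ1) hz
    have m1 : MemLp φ 2 G.vol := G.memLp_vol hφ.continuous
    have m2 : MemLp φ 2 (arc.restrict G.Γ) := memLp_Γ (G.memLp_bdry hφ.continuous)
    have e1 : ∫ p in G.Ω₂, φ p * (l p - l' p) =
        (∫ p in G.Ω₂, l p * φ p) - ∫ p in G.Ω₂, l' p * φ p := by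
      refine Eq.trans (integral_congr_ae (ae_of_all _ fun p => ?_))
        (integral_sub (hl.integrable_mul m1) (hl'.integrable_mul m1))
      ring
    have e2 : ∫ p in G.Γ, φ p * (q p - q' p) ∂arc =
        (∫ p in G.Γ, q p * φ p ∂arc) - ∫ p in G.Γ, q' p * φ p ∂arc := by
      refine Eq.trans (integral_congr_ae (ae_of_all _ fun p => ?_))
        (integral_sub (hq.integrable_mul m2) (hq'.integrable_mul m2))
      ring
    rw [e1, e2, ← e, ← e']
    simp only [smoothH1]
    ring
  -- Test functions supported inside `Ω₂` see no boundary term, so the two Laplacians agree first.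
  have hll : ∀ᵐ p, p ∈ G.Ω₂ → l p - l' p = 0 := by
    refine G.isOpen_Ω₂.ae_eq_zero_of_integral_contDiff_smul_eq_zero ?_ fun φ hφ hc hs => ?_
    · have : IntegrableOn (fun p => l p - l' p) G.Ω₂ := (hl.sub hl').integrable (by norm_num)
      exact this.locallyIntegrableOn
    · have hφ0 : ∀ p, p ∉ G.Ω₂ → φ p = 0 := fun p hp =>
        image_eq_zero_of_notMem_tsupport fun h => hp (hs h)
      have hfr : ∀ p ∈ frontier G.Ω₂, φ p = 0 := fun p hp => hφ0 p (by
        rw [G.isOpen_Ω₂.frontier_eq] at hp; exact hp.2)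
      have e := hdiff φ hφ fun p hp => hfr p hp.1
      rw [setIntegral_eq_integral_of_forall_compl_eq_zero (fun x hx => by
        rw [hφ0 x hx, zero_mul])] at e
      simp only [smul_eq_mul]
      rw [e]
      refine integral_eq_zero_of_ae ?_
      filter_upwards [ae_restrict_mem G.measurableSet_Γ] with p hp
      simp [hfr p (G.Γ_subset_frontier hp)]
  have hll' : ∀ φ : Plane → ℝ, ∫ p in G.Ω₂, φ p * (l p - l' p) = 0 := fun φ => by
    refine integral_eq_zero_of_ae ?_
    rw [EventuallyEq, ae_restrict_iff' G.isOpen_Ω₂.measurableSet]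
    filter_upwards [hll] with p hp hm
    simp [hp hm]
  have hmap : Integrable (fun p => q p - q' p) (arc.restrict G.Γ) :=
    (hq.sub hq').integrable (by norm_num)
  have hint : IntegrableOn (fun z => q (pt G.L₀ z) - q' (pt G.L₀ z)) (Ioo 0 G.H) := by
    rw [arc_restrict_Γ, G.measurableEmbedding_interface.integrable_map_iff] at hmap
    exact hmap
  have hqq : ∀ᵐ z : ℝ, z ∈ Ioo 0 G.H → q (pt G.L₀ z) - q' (pt G.L₀ z) = 0 := by
    refine isOpen_Ioo.ae_eq_zero_of_integral_contDiff_smul_eq_zero hint.locallyIntegrableOn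
      fun g hg hc hs => ?_
    have hg0 : ∀ z, z ∉ Ioo 0 G.H → g z = 0 := fun z hz =>
      image_eq_zero_of_notMem_tsupport fun h => hz (hs h)
    have hpos : 0 < G.L₂ - G.L₀ := sub_pos.2 G.L₀_lt
    -- The cutoff is `1` at `x = L₀` and `0` for `x ≥ L₂`; with `g` supported in `(0, H)`, the
    -- product vanishes on the boundary off `Γ` and equals `g` on `Γ`.
    set φ : Plane → ℝ := fun p => Real.smoothTransition ((G.L₂ - p 0) / (G.L₂ - G.L₀)) * g (p 1)
      with hφdef
    have hφ : ContDiff ℝ ∞ φ := by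
      refine ContDiff.mul (Real.smoothTransition.contDiff.comp ?_) (hg.comp ?_)
      · fun_prop
      · fun_prop
    have e := hdiff φ hφ fun p hp => by
      by_contra hne
      have h1 : p 1 ∈ Ioo 0 G.H := by
        by_contra h; exact hne (by simp only [hφdef]; rw [hg0 _ h, mul_zero])
      have h0 : p 0 < G.L₂ := by
        by_contra h
        refine hne ?_
        simp only [hφdef]
        rw [Real.smoothTransition.zero_of_nonpos, zero_mul]
        exact div_nonpos_of_nonpos_of_nonneg (by linarith) hpos.le
      exact hp.2 (mem_Γ_of_mem_frontier hp.1 h0 h1)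
    rw [hll' φ, integral_Γ, intervalIntegral.integral_of_le G.H_pos.le,
      integral_Ioc_eq_integral_Ioo] at e
    rw [← setIntegral_eq_integral_of_forall_compl_eq_zero (s := Ioo 0 G.H) (fun x hx => by
        rw [hg0 x hx, zero_smul])]
    refine Eq.trans (integral_congr_ae (ae_of_all _ fun z => ?_)) e.symm
    simp only [hφdef, pt_zero, pt_one]
    rw [div_self hpos.ne', Real.smoothTransition.one, one_mul, smul_eq_mul]
  rw [arc_restrict_Γ, EventuallyEq, G.measurableEmbedding_interface.ae_map_iff,
    ae_restrict_iff' measurableSet_Ioo]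
  filter_upwards [hqq] with z hz hm using sub_eq_zero.1 (hz hm)

lemma avg_congr {f g : Plane → ℝ} (h : f =ᵐ[arc.restrict G.Γ] g) :
    G.avg f G.L₀ = G.avg g G.L₀ := by
  rw [avg_eq_integral_Γ, avg_eq_integral_Γ, integral_congr_ae h]

lemma avg_neg_robin {c lam : ℝ} {w : Plane → ℝ} (hw : MemLp w 2 G.bdry) :
    G.avg (fun p => -(c - lam * w p)) G.L₀ = lam * G.avg w G.L₀ - c := by
  have hi : Integrable w (arc.restrict G.Γ) := (memLp_Γ hw).integrable (by norm_num)
  have e : ∫ p in G.Γ, -(c - lam * w p) ∂arc = lam * (∫ p in G.Γ, w p ∂arc) - G.H * c := by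
    have : ∫ p in G.Γ, -(c - lam * w p) ∂arc = ∫ p in G.Γ, (lam * w p - c) ∂arc :=
      integral_congr_ae (ae_of_all _ fun p => by ring)
    rw [this, integral_sub (hi.const_mul lam) (integrable_const c), integral_const_mul]
    simp [Measure.real, arc_Γ, G.H_pos.le]
  have := G.H_pos.ne'
  rw [avg_eq_integral_Γ, avg_eq_integral_Γ, e]
  field_simp

/-- The interface averages of a weak solution with Robin datum `c`. -/
lemma hasInterfaceAverages_iff {κ lam c : ℝ} {F γ₂ w : Plane → ℝ} (hF : MemLp F 2 G.vol)
    {u : H1 G.Ω₂} (hu : IsSolution2D G κ lam F γ₂ c u) (hw : u.HasTrace w) (m d : ℝ) :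
    HasInterfaceAverages G u m d ↔ m = G.avg w G.L₀ ∧ d = lam * G.avg w G.L₀ - c := by
  have hn := hasNormalDeriv_of_isSolution2D hF hu hw
  constructor
  · rintro ⟨w', q, hw', hq, rfl, rfl⟩
    refine ⟨avg_congr (ae_restrict_of_ae_restrict_of_subset G.Γ_subset_frontier (hw'.ae_eq hw)), ?_⟩
    rw [← avg_neg_robin hw.1]
    refine avg_congr ?_
    filter_upwards [normalDeriv_ae_eq hq hn] with p hp
    rw [hp]
  · rintro ⟨rfl, rfl⟩
    exact ⟨w, _, hw, hn, rfl, (avg_neg_robin hw.1).symm⟩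

end Geometry

/-! ### The scalar recursion and convergence of the iteration. -/

lemma tendsto_of_affine_recursion {a : ℕ → ℝ} {A B : ℝ} (hB : |B| < 1)
    (h : ∀ k, a (k + 1) = A + B * a k) : Tendsto a atTop (𝓝 (A / (1 - B))) := by
  have h1 : 1 - B ≠ 0 := by have := (abs_lt.1 hB).2; linarith
  have hk : ∀ k, a k = A / (1 - B) + B ^ k * (a 0 - A / (1 - B)) := by
    intro k
    induction k with
    | zero => simp
    | succ k ih =>
      rw [h, ih, pow_succ]
      field_simp
      ring
  have := ((tendsto_pow_atTop_nhds_zero_of_abs_lt_one hB).mul_const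
    (a 0 - A / (1 - B))).const_add (A / (1 - B))
  rw [zero_mul, add_zero] at this
  exact this.congr fun k => (hk k).symm

lemma tendsto_eLpNorm_of_eq_smul {f : ℕ → ℝ → ℝ} {g : ℝ → ℝ} {s : ℕ → ℝ} {L : ℝ}
    (hg : Continuous g) (hs : Tendsto s atTop (𝓝 0))
    (hf : ∀ k, ∀ x ∈ Icc 0 L, f (k + 1) x = s k * g x) :
    Tendsto (fun k => eLpNorm (f k) 2 (volume.restrict (Ioo 0 L))) atTop (𝓝 0) := by
  -- The term of index `0` is arbitrary in the iteration and is dropped.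
  rw [← tendsto_add_atTop_iff_nat 1]
  have hfin : eLpNorm g 2 (volume.restrict (Ioo 0 L)) ≠ ⊤ := by
    obtain ⟨c, hc⟩ := isCompact_Icc.exists_bound_of_continuousOn (hg.continuousOn (s := Icc 0 L))
    refine (MemLp.of_bound hg.aestronglyMeasurable c ?_).eLpNorm_ne_top
    filter_upwards [ae_restrict_mem measurableSet_Ioo] with x hx using hc x (Ioo_subset_Icc_self hx)
  have e : ∀ k, eLpNorm (f (k + 1)) 2 (volume.restrict (Ioo 0 L)) =
      ‖s k‖ₑ * eLpNorm g 2 (volume.restrict (Ioo 0 L)) := by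
    intro k
    rw [← eLpNorm_const_smul]
    refine eLpNorm_congr_ae ?_
    filter_upwards [ae_restrict_mem measurableSet_Ioo] with x hx
    rw [hf k x (Ioo_subset_Icc_self hx)]
    rfl
  have h0 : Tendsto (fun k => ‖s k‖ₑ) atTop (𝓝 0) := by
    simpa [Function.comp_def] using (continuous_enorm.tendsto (0 : ℝ)).comp hs
  simp only [e]
  simpa using ENNReal.Tendsto.mul_const h0 (Or.inr hfin)

namespace Geometry

variable {G : Geometry}

lemma convergesH1_of_tendsto {u : ℕ → H1 G.Ω₂} {v : H1 G.Ω₂} {w : ℕ → Plane → ℝ} {y : Plane → ℝ}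
    (hw : ∀ k, MemLp (w k) 2 G.bdry) (hy : MemLp y 2 G.bdry)
    (h : Tendsto (fun k => (u (k + 1)).toTriple (hw k)) atTop (𝓝 (v.toTriple hy))) :
    ConvergesH1 u v := by
  constructor
  · rw [← tendsto_add_atTop_iff_nat 1]
    exact (Lp.tendsto_Lp_iff_tendsto_eLpNorm'' _ (fun k => (u (k + 1)).memLp_val) _ v.memLp_val).1
      ((G.valL.continuous.tendsto _).comp h)
  · rw [← tendsto_add_atTop_iff_nat 1]
    exact (Lp.tendsto_Lp_iff_tendsto_eLpNorm'' _ (fun k => (u (k + 1)).memLp_grad) _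
      v.memLp_grad).1 ((G.gradL.continuous.tendsto _).comp h)

end Geometry

/-- Iterates are built by recursion on functions bundled with the existence of their interface
averages, the invariant that permits the next step. -/
lemma exists_iteration {G : Geometry} {κ lam : ℝ} {F γ₁ γ₂ : Plane → ℝ}
    (hstep : ∀ u : H1 G.Ω₂, (∃ m d, HasInterfaceAverages G u m d) →
      ∃ (u₁ du₁ : ℝ → ℝ) (u' : H1 G.Ω₂), (∃ m d, HasInterfaceAverages G u' m d) ∧
        IsSolution1D G κ F γ₁ u₁ du₁ ∧ Robin1D G lam u₁ du₁ u ∧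
        IsSolution2D G κ lam F γ₂ (robinDatum2D G lam u₁ du₁) u')
    (u : H1 G.Ω₂) (hu : ∃ m d, HasInterfaceAverages G u m d) :
    ∃ (u₁ du₁ : ℕ → ℝ → ℝ) (u₂ : ℕ → H1 G.Ω₂), u₂ 0 = u ∧
      IsSchwarzIteration G κ lam F γ₁ γ₂ u₁ du₁ u₂ := by
  choose f df next hnext h1 h2 h3 using hstep
  let s : ℕ → {u : H1 G.Ω₂ // ∃ m d, HasInterfaceAverages G u m d} := fun k =>
    Nat.rec ⟨u, hu⟩ (fun _ v => ⟨next v.1 v.2, hnext v.1 v.2⟩) k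
  -- The one-dimensional iterate of index `k` comes from the two-dimensional one of index `k - 1`;
  -- the truncated value at `k = 0` is irrelevant.
  exact ⟨fun k => f (s (k - 1)).1 (s (k - 1)).2, fun k => df (s (k - 1)).1 (s (k - 1)).2,
    fun k => (s k).1, rfl, fun k => ⟨h1 _ _, h2 _ _, h3 _ _⟩⟩

/-- The contraction factor of the iteration is less than one. -/
lemma abs_contraction_lt_one {lam M S C : ℝ} (hlam : 0 < lam) (hS : 0 < S) (hC : 0 < C)
    (hM : 0 ≤ M) (hM' : lam * M ≤ 1) :
    |(2 * lam * M - 1) * (lam * S - C) / (C + lam * S)| < 1 := by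
  have hd : 0 < C + lam * S := by positivity
  rw [abs_div, abs_of_pos hd, div_lt_one hd, abs_mul]
  -- This factor may have modulus `1`; strictness comes from the other one, because both `C` and
  -- `lam * S` are positive.
  have h1 : |2 * lam * M - 1| ≤ 1 := abs_le.2 ⟨by nlinarith, by linarith⟩
  have hlS : 0 < lam * S := by positivity
  have h2 : |lam * S - C| < C + lam * S := abs_lt.2 ⟨by linarith, by linarith⟩
  calc |2 * lam * M - 1| * |lam * S - C| ≤ 1 * |lam * S - C| := by gcongr
    _ < _ := by rwa [one_mul]

end SchwarzCoupling

end

open SchwarzCoupling in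
theorem mainTheorem1 (G : SchwarzCoupling.Geometry) (κ : ℝ) (hκ : 0 ≤ κ)
    (F γ₁ γ₂ : SchwarzCoupling.Plane → ℝ)
    (hF : MemLp F 2 (volume.restrict G.Ω))
    (hγ₁ : IntervalIntegrable (fun z => γ₁ (SchwarzCoupling.pt 0 z)) volume 0 G.H)
    (hγ₂ : SchwarzCoupling.IsDirichletDatum G γ₂)
    (lam : ℝ) (hlam : 0 < lam) :
    -- the algorithm is well defined for every initial guess with a value and a flux on `Γ`
    (∀ u₂init : SchwarzCoupling.H1 G.Ω₂,
      (∃ m d : ℝ, SchwarzCoupling.HasInterfaceAverages G u₂init m d) →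
      ∃ (u₁ du₁ : ℕ → ℝ → ℝ) (u₂ : ℕ → SchwarzCoupling.H1 G.Ω₂), u₂ 0 = u₂init ∧
        SchwarzCoupling.IsSchwarzIteration G κ lam F γ₁ γ₂ u₁ du₁ u₂) ∧
    -- there is a limit, depending only on `lam` and the data of the problem
    ∃ (u₁lim du₁lim : ℝ → ℝ) (u₂lim : SchwarzCoupling.H1 G.Ω₂),
      -- it solves the two models with the Robin condition on `Γ`
      SchwarzCoupling.IsSolution1D G κ F γ₁ u₁lim du₁lim ∧
      SchwarzCoupling.IsSolution2D G κ lam F γ₂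
        (SchwarzCoupling.robinDatum2D G lam u₁lim du₁lim) u₂lim ∧
      -- it satisfies the physical constraints
      SchwarzCoupling.HasInterfaceAverages G u₂lim (u₁lim G.L₀) (du₁lim G.L₀) ∧
      -- every Schwarz iteration converges to it
      ∀ (u₁ du₁ : ℕ → ℝ → ℝ) (u₂ : ℕ → SchwarzCoupling.H1 G.Ω₂),
        SchwarzCoupling.IsSchwarzIteration G κ lam F γ₁ γ₂ u₁ du₁ u₂ →
        SchwarzCoupling.ConvergesH1Interval G.L₀ u₁ du₁ u₁lim du₁lim ∧
        SchwarzCoupling.ConvergesH1 u₂ u₂lim := by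
  have hF₂ : MemLp F 2 G.vol := hF.mono_measure (Measure.restrict_mono inter_subset_left le_rfl)
  obtain ⟨C, S, hCS⟩ := exists_isFundamentalPair (div_nonneg hκ G.H_pos.le)
  obtain ⟨p, dp, hp⟩ := exists_isSolution1D (γ₁ := γ₁) hκ hF
  obtain ⟨x₀, x₁, hx₀, hx₁, hM, hM', hsol, hsol'⟩ :=
    Geometry.exists_affine_solution2D hκ hlam hF₂ hγ₂
  have hC := hCS.C_pos G.L₀
  have hS := hCS.S_pos _ G.L₀_pos
  have hden : C G.L₀ + lam * S G.L₀ ≠ 0 := by positivity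
  have hHpos := G.H_pos
  have hLmem : G.L₀ ∈ Icc 0 G.L₀ := ⟨G.L₀_pos.le, le_rfl⟩
  -- The datum `c` produces the mean `m₀ + c M` on `Γ`. The solution `p + a S` sends the datum `c₀ +
  -- a E` to `Ω₂`, and its own Robin value `u' + lam u` at `L₀` is `r₀ + a D`.
  set m₀ := G.interfaceL x₀ / G.H with hm₀
  set M := G.interfaceL x₁ / G.H with hMdef
  set c₀ := -dp G.L₀ + lam * p G.L₀ with hc₀
  set r₀ := dp G.L₀ + lam * p G.L₀ with hr₀
  set D := C G.L₀ + lam * S G.L₀ with hD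
  set E := lam * S G.L₀ - C G.L₀ with hE
  have hB : |(2 * lam * M - 1) * E / D| < 1 :=
    abs_contraction_lt_one hlam hS hC (div_nonneg hM hHpos.le) (by
      rw [hMdef, ← mul_div_assoc, div_le_one hHpos]; exact hM')
  set B := (2 * lam * M - 1) * E / D with hBdef
  -- A solution with datum `c` and mean `m` returns `2 lam m - c`. Setting `r₀ + a (k+1) D` equal to
  -- this for `c = c₀ + a k E` and solving gives `A` and `B`.
  set A := (2 * lam * (m₀ + c₀ * M) - c₀ - r₀) / D with hAdef
  have hmem : ∀ c : ℝ, x₀ + c • x₁ ∈ G.sobolev := fun c =>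
    G.sobolev.add_mem hx₀ (G.sobolev.smul_mem c hx₁)
  have havg : ∀ (c : ℝ) (u : H1 G.Ω₂) (w : Plane → ℝ) (h : u.HasTrace w),
      u.toTriple h.1 = x₀ + c • x₁ → G.avg w G.L₀ = m₀ + c * M := fun c u w h hx => by
    rw [Geometry.avg_eq_interfaceL (v := u) h.1, hx, map_add, map_smul, smul_eq_mul, hm₀, hMdef]
    ring
  have hdatum : ∀ α : ℝ, robinDatum2D G lam (fun x => p x + α * S x) (fun x => dp x + α * C x) =
      c₀ + α * E := fun α => by
    simp only [robinDatum2D, hc₀, hE]; ring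
  refine ⟨exists_iteration fun u ⟨m, d, hmd⟩ => ?_, ?_⟩
  -- One step from an arbitrary function: `α` solves the scalar Robin condition `r₀ + α D = d + lam
  -- m`.
  · set α := (d + lam * m - r₀) / D with hα
    obtain ⟨u', w, hw, hx⟩ := Geometry.exists_toTriple_eq (hmem (c₀ + α * E))
    have hu' := hsol' _ u' w hw hx
    refine ⟨_, _, u', ⟨_, _, (Geometry.hasInterfaceAverages_iff hF₂ hu' hw _ _).2 ⟨rfl, rfl⟩⟩,
      hp.add_smul hCS α, ⟨m, d, hmd, ?_⟩, ?_⟩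
    · have : α * D = d + lam * m - r₀ := div_mul_cancel₀ _ hden
      simp only
      linear_combination this
    · rwa [hdatum]
  set α := A / (1 - B) with hα
  have hfix : α = A + B * α := by
    have : 1 - B ≠ 0 := by have := (abs_lt.1 hB).2; linarith
    rw [hα]; field_simp; ring
  have hfix' : α * D + r₀ = 2 * lam * (m₀ + (c₀ + α * E) * M) - (c₀ + α * E) := by
    have : α * D = A * D + B * D * α := by linear_combination D * hfix
    have hAD : A * D = 2 * lam * (m₀ + c₀ * M) - c₀ - r₀ := div_mul_cancel₀ _ hden
    have hBD : B * D = (2 * lam * M - 1) * E := div_mul_cancel₀ _ hden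
    rw [hAD, hBD] at this
    linear_combination this
  obtain ⟨v, w, hw, hx⟩ := Geometry.exists_toTriple_eq (hmem (c₀ + α * E))
  have hv := hsol' _ v w hw hx
  refine ⟨fun x => p x + α * S x, fun x => dp x + α * C x, v, hp.add_smul hCS α, ?_, ?_, ?_⟩
  · rwa [hdatum]
  · rw [Geometry.hasInterfaceAverages_iff hF₂ hv hw, havg _ v w hw hx]
    -- The sum of the two Robin conditions: the derivatives cancel and the means are left,
    -- multiplied by `2 lam ≠ 0`.
    have h2 : 2 * lam * (p G.L₀ + α * S G.L₀ - (m₀ + (c₀ + α * E) * M)) = 0 := by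
      linear_combination hfix'
    have h3 : p G.L₀ + α * S G.L₀ - (m₀ + (c₀ + α * E) * M) = 0 := by
      rcases mul_eq_zero.1 h2 with h | h
      · exact absurd h (by positivity)
      · exact h
    refine ⟨by linarith, ?_⟩
    linear_combination lam * h3
  · intro u₁ du₁ u₂ hit
    -- `a k` is the coefficient of the iterate of index `k + 1`; hence the recursion links only
    -- two-dimensional iterates that solve the Robin problem, and the initial guess enters through
    -- `a 0` alone.
    choose a ha using fun k => hp.eq_add_smul hCS (hit k).1
    have hdat : ∀ k, robinDatum2D G lam (u₁ (k + 1)) (du₁ (k + 1)) = c₀ + a k * E := fun k => by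
      rw [robinDatum2D, (ha k _ hLmem).1, (ha k _ hLmem).2, hc₀, hE]; ring
    have h2 : ∀ k, IsSolution2D G κ lam F γ₂ (c₀ + a k * E) (u₂ (k + 1)) := fun k => by
      rw [← hdat]; exact (hit k).2.2
    choose y hy hyx using fun k => hsol _ _ (h2 k)
    have hrec : ∀ k, a (k + 1) = A + B * a k := by
      intro k
      obtain ⟨m, d, hmd, hrob⟩ := (hit (k + 1)).2.1
      rw [Geometry.hasInterfaceAverages_iff hF₂ (h2 k) (hy k), havg _ _ _ (hy k) (hyx k)] at hmd
      rw [(ha (k + 1) _ hLmem).1, (ha (k + 1) _ hLmem).2, hmd.1, hmd.2] at hrob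
      refine mul_right_cancel₀ hden ?_
      have hAD : A * D = 2 * lam * (m₀ + c₀ * M) - c₀ - r₀ := div_mul_cancel₀ _ hden
      have hBD : B * D = (2 * lam * M - 1) * E := div_mul_cancel₀ _ hden
      have e : (A + B * a k) * D = A * D + B * D * a k := by ring
      change a (k + 1) * D = (A + B * a k) * D
      rw [e, hAD, hBD]
      linear_combination hrob
    have hlim : Tendsto a atTop (𝓝 α) := tendsto_of_affine_recursion hB hrec
    have hlim0 : Tendsto (fun k => a k - α) atTop (𝓝 0) := by
      simpa using hlim.sub_const α
    refine ⟨⟨?_, ?_⟩, ?_⟩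
    · refine tendsto_eLpNorm_of_eq_smul hCS.continuous_S hlim0 fun k x hx => ?_
      simp only [(ha k x hx).1]
      ring
    · refine tendsto_eLpNorm_of_eq_smul hCS.continuous_C hlim0 fun k x hx => ?_
      simp only [(ha k x hx).2]
      ring
    · refine Geometry.convergesH1_of_tendsto (fun k => (hy k).1) hw.1 ?_
      simp only [hyx, hx]
      exact (((hlim.mul_const E).const_add c₀).smul_const x₁).const_add x₀
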